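/- Let $M$ be a non-compact smooth manifold (without boundary, finite-dimensional, Hausdorff, second countable). "Near infinity" means: on the complement of some compact subset of $M$. A \emph{cylindrical structure} on $M$ is a pair $(t,X)$, where $t:M\to\mathbb R$ is a proper continuous function, bounded below and smooth near infinity, and $X$ is a smooth vector field on $M$ with $X(t)=1$ near infinity; one also writes $X=\partial_t$. Relative to such a structure: - a smooth vector field $Z$ is \emph{constant} if $[Z,X]=0$ near infinity; - a smooth function $f:M\to\mathbb R$ is \emph{bounded with all its derivatives} if $D(f)$ is bounded on $M$ for every $D$ in the (unital) associative algebra of differential operators generated by the constant vector fields, i.e. $f$ and all $Z_1Z_2\cdots Z_k(f)$, with $Z_1,\dots,Z_k$ constant, are bounded; - a smooth vector field is \emph{strongly bounded} if it is a finite sum $\sum_i f_iZ_i$ with $Z_i$ constant vector fields and $f_i$ smooth functions bounded with all their derivatives; a vector field that is only defined near infinity is called strongly bounded if it agrees near infinity with a strongly bounded smooth vector field on $M$; - a smooth vector field $Z$ is \emph{perpendicular} if $Z(t)=0$ near infinity. **Theorem.** Let $(t,\partial_t)$ be a cylindrical structure on $M$ and let $Y=\partial_t+Y_\perp$, where $Y_\perp$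 is a smooth perpendicular vector field on $M$. Assume that for some real $\varepsilon>0$ the field $t^{1+\varepsilon}Y_\perp$ (defined near infinity) is strongly bounded with respect to $(t,\partial_t)$. Then $(t,Y)$ is also a cylindrical structure on $M$, and a smooth function $f:M\to\mathbb R$ is bounded with all its derivatives with respect to $(t,\partial_t)$ if and only if it is bounded with all its derivatives with respect to $(t,Y)$. -/

import Mathlib

open Filter Topology
open scoped Manifold ContDiff

noncomputable section

namespace CylindricalEnd

/-- Smooth vector fields on a smooth `n`-manifold, as smooth sections of the tangent bundle. -/
abbrev SmoothVectorField (n : ℕ) (M : Type*) [TopologicalSpace M]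
    [ChartedSpace (EuclideanSpace ℝ (Fin n)) M] [IsManifold (𝓡 n) ∞ M] :=
  ContMDiffSection (𝓡 n) (EuclideanSpace ℝ (Fin n)) ∞ (TangentSpace (𝓡 n) : M → Type)

section

variable {n : ℕ} {M : Type*} [TopologicalSpace M] [ChartedSpace (EuclideanSpace ℝ (Fin n)) M]
  [IsManifold (𝓡 n) ∞ M]

/-- The derivative `X(g)` of a real function `g` along the vector field `X`. -/
def fieldDeriv (X : SmoothVectorField n M) (g : M → ℝ) (x : M) : ℝ :=
  mvfderiv (𝓡 n) g x (X x)

theorem contMDiff_fieldDeriv (X : SmoothVectorField n M) {g : M → ℝ}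
    (hg : ContMDiff (𝓡 n) 𝓘(ℝ, ℝ) ∞ g) :
    ContMDiff (𝓡 n) 𝓘(ℝ, ℝ) ∞ (fieldDeriv X g) := by
  have h1 := hg.contMDiff_tangentMap (m := ∞) (by simp)
  exact (contMDiff_snd_tangentBundle_modelSpace ℝ 𝓘(ℝ, ℝ)).comp (h1.comp X.contMDiff)

/-- A smooth vector field as a linear operator on the space of smooth functions. -/
def fieldOperator (X : SmoothVectorField n M) : Module.End ℝ C^∞⟮𝓡 n, M; ℝ⟯ where
  toFun f := ⟨fieldDeriv X f, contMDiff_fieldDeriv X f.contMDiff⟩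
  map_add' f g := by
    ext x
    have hf : MDifferentiableAt (𝓡 n) 𝓘(ℝ, ℝ) f x := f.contMDiff.mdifferentiable (by simp) x
    have hg : MDifferentiableAt (𝓡 n) 𝓘(ℝ, ℝ) g x := g.contMDiff.mdifferentiable (by simp) x
    change mvfderiv (𝓡 n) (⇑f + ⇑g) x (X x)
      = mvfderiv (𝓡 n) (⇑f) x (X x) + mvfderiv (𝓡 n) (⇑g) x (X x)
    rw [mvfderiv_add hf hg]
    rfl
  map_smul' c f := by
    ext x
    have hf : MDifferentiableAt (𝓡 n) 𝓘(ℝ, ℝ) f x := f.contMDiff.mdifferentiable (by simp) x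
    change mvfderiv (𝓡 n) ((fun _ => c : M → ℝ) • ⇑f) x (X x) = c * mvfderiv (𝓡 n) (⇑f) x (X x)
    rw [mvfderiv_smul mdifferentiableAt_const hf]
    simp [mvfderiv]

/-- `(t, X)` is a cylindrical structure on `M` (`X` plays the role of `∂_t`): `t` is smooth near
infinity, proper and bounded below, and `X(t) = 1` near infinity. A property holds on the complement
of some compact subset exactly when it holds eventually along `cocompact M`. -/
structure IsCylindricalStructure (t : M → ℝ) (X : SmoothVectorField n M) : Prop where
  smooth : ∀ᶠ x in cocompact M, ContMDiffAt (𝓡 n) 𝓘(ℝ, ℝ) ∞ t x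
  proper : IsProperMap t
  bddBelow : ∃ a : ℝ, ∀ x, a ≤ t x
  deriv_eq_one : ∀ᶠ x in cocompact M, fieldDeriv X t x = 1

/-- `Z` is a constant vector field for a cylindrical structure `(t, X)`: it commutes with `X` near
infinity. -/
def IsConstantField (X Z : SmoothVectorField n M) : Prop :=
  ∀ᶠ x in cocompact M, VectorField.mlieBracket (𝓡 n) Z X x = 0

/-- The differential operators with constant coefficients for a cylindrical structure `(t, X)`: the
associative algebra of operators generated by the constant vector fields. -/
def constantOperators (X : SmoothVectorField n M) :
    Subalgebra ℝ (Module.End ℝ C^∞⟮𝓡 n, M; ℝ⟯) :=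
  Algebra.adjoin ℝ {D | ∃ Z : SmoothVectorField n M, IsConstantField X Z ∧ D = fieldOperator Z}

/-- `f` is bounded with all its derivatives for a cylindrical structure `(t, X)`. -/
def IsBoundedWithDerivatives (X : SmoothVectorField n M) (f : C^∞⟮𝓡 n, M; ℝ⟯) : Prop :=
  ∀ D ∈ constantOperators X, ∃ C : ℝ, ∀ x, |D f x| ≤ C

/-- `Z` is strongly bounded for a cylindrical structure `(t, X)`: a finite linear combination of
constant vector fields with coefficients bounded with all their derivatives. -/
def IsStronglyBounded (X Z : SmoothVectorField n M) : Prop :=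
  ∃ (m : ℕ) (f : Fin m → C^∞⟮𝓡 n, M; ℝ⟯) (V : Fin m → SmoothVectorField n M),
    (∀ i, IsBoundedWithDerivatives X (f i)) ∧ (∀ i, IsConstantField X (V i)) ∧
      ∀ x, Z x = ∑ i, f i x • V i x

/-- Strong boundedness of a field `Z` which is only meaningful near infinity (such as `t ^ s • Y`,
since `t` need not be smooth or positive on compact parts): `Z` agrees on the complement of a
compact set with a smooth strongly bounded vector field on `M`. Fields with compact support are
strongly bounded, so this does not depend on the smooth extension. -/
def IsStronglyBoundedNearInfinity (X : SmoothVectorField n M)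
    (Z : (x : M) → TangentSpace (𝓡 n) x) : Prop :=
  ∃ W : SmoothVectorField n M, IsStronglyBounded X W ∧ ∀ᶠ x in cocompact M, W x = Z x

/-- `Z` is perpendicular: `Z(t) = 0` near infinity. -/
def IsPerpendicular (t : M → ℝ) (Z : SmoothVectorField n M) : Prop :=
  ∀ᶠ x in cocompact M, fieldDeriv Z t x = 0

end

end CylindricalEnd

end

/-! Write `P` for the perpendicular field, `Y = X + P`, and `A(X)`, `A(Y)` for the spaces of
functions bounded with all derivatives for the two structures. Near infinity `t` equals a smooth
exhaustion `τ`, and the hypothesis says that `P` kills `τ` there and maps `A(X)` into `ρ * A(X)`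
with `ρ = τ ^ (-(1 + ε))`. Now `A(X)` is the largest space of bounded functions stable under the
`X`-constant fields (`le_boundedSubmodule`), so each inclusion between `A(X)` and `A(Y)` amounts to
stability of one space under the constant fields of the other structure.

Geometric input (`exists_constant_frame`): there are finitely many functions `u i`, each
`X`-invariant or equal to `τ`, and `X`-constant fields `V i` with `v = ∑ du_i(v) V_i` near infinity.
The invariant functions are pulled back from a level set of `τ` along the flow of `X`, and the `V i`
are the gradients of the `u i` for the `X`-invariant metric `∑ (du_i)²`. A field is thus known
through its coefficients `Z(u i)`, which are invariant if `Z` is `X`-constant.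

Analytic input (`bounded_of_linear_system`): if finitely many functions satisfy `Y g_i = ∑ A_ij g_j`
with `A_ij = O(τ ^ (-(1 + ε)))`, they are bounded, since the rate is integrable in `τ`. Adjoining
all `V_k g` to such a system gives another one (`system_extend`), because `[Y, V_k]` has decaying
coefficients in the frame. Iteration puts every solution in `A(X)`.

For `A(X) ≤ A(Y)`, let `Z` be `Y`-constant: the `Z(u l)` solve a decaying system, as `Y Z u_l = Z Y
u_l = ∑ Z(u_j) V_j(P u_l)`. So they lie in `A(X)`, and so does `Z f = ∑ Z(u_l) V_l f` for `f` in
`A(X)`. For the converse a frame `(w, W)` of `Y` is used. Its invariant functions solve a system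
with zero coefficients, hence lie in `A(X)`; for `X`-constant `Z` the coefficients `Z(w_l)` lie in
`A(X) ≤ A(Y)`. -/

noncomputable section

namespace CylindricalEnd

/-! ### Calculus on spaces of curves: superposition and integration operators. -/

section LocalFlow

universe v

variable {K : Type*} [TopologicalSpace K] [CompactSpace K]

/-- Pointwise application of a continuous family of continuous linear maps to a continuous
function, as a continuous bilinear map. -/
def pointwiseApply (K : Type*) [TopologicalSpace K] [CompactSpace K]
    (E G : Type*) [NormedAddCommGroup E] [NormedSpace ℝ E]
    [NormedAddCommGroup G] [NormedSpace ℝ G] :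
    C(K, E →L[ℝ] G) →L[ℝ] C(K, E) →L[ℝ] C(K, G) :=
  LinearMap.mkContinuous₂
    (LinearMap.mk₂ ℝ (fun (A : C(K, E →L[ℝ] G)) (h : C(K, E)) =>
      (⟨fun p => A p (h p), by fun_prop⟩ : C(K, G)))
      (fun _ _ _ => by ext; simp) (fun _ _ _ => by ext; simp)
      (fun _ _ _ => by ext; simp) (fun _ _ _ => by ext; simp)) 1
    (fun A h => by
      rw [one_mul, ContinuousMap.norm_le _ (by positivity)]
      intro p
      exact ((A p).le_opNorm _).trans
        (mul_le_mul (A.norm_coe_le_norm p) (h.norm_coe_le_norm p) (norm_nonneg _) (by positivity)))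

@[simp]
theorem pointwiseApply_apply {E G : Type*} [NormedAddCommGroup E] [NormedSpace ℝ E]
    [NormedAddCommGroup G] [NormedSpace ℝ G] (A : C(K, E →L[ℝ] G)) (h : C(K, E)) (p : K) :
    pointwiseApply K E G A h p = A p (h p) := rfl

/-- The superposition operator `γ ↦ f ∘ γ` on continuous functions is differentiable. -/
theorem hasFDerivAt_postcomp {E G : Type*} [NormedAddCommGroup E] [NormedSpace ℝ E]
    [NormedAddCommGroup G] [NormedSpace ℝ G] (f : C(E, G)) (f' : C(E, E →L[ℝ] G))
    (hf : ∀ x, HasFDerivAt f (f' x) x) (γ : C(K, E)) :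
    HasFDerivAt (fun γ : C(K, E) => f.comp γ) (pointwiseApply K E G (f'.comp γ)) γ := by
  rw [hasFDerivAt_iff_isLittleO_nhds_zero, Asymptotics.isLittleO_iff]
  intro c hc
  have hcont : Continuous (fun γ : C(K, E) => f'.comp γ) := ContinuousMap.continuous_postcomp f'
  obtain ⟨δ, hδ, H⟩ := (Metric.continuousAt_iff (f := fun γ : C(K, E) => f'.comp γ)
    (a := γ)).1 (by exact hcont.continuousAt) c hc
  filter_upwards [Metric.ball_mem_nhds (0 : C(K, E)) hδ] with h hh
  rw [ContinuousMap.norm_le _ (by positivity)]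
  intro p
  have key : ∀ z ∈ Metric.ball (γ p) δ, ‖f' z - f' (γ p)‖ ≤ c := by
    intro z hz
    -- Translating the whole curve by `z - γ p` turns continuity of `γ ↦ f' ∘ γ` into an estimate at
    -- `p` with `δ` independent of `p`.
    have h1 : dist (γ + ContinuousMap.const K (z - γ p)) γ < δ := by
      rw [dist_eq_norm, add_sub_cancel_left]
      refine lt_of_le_of_lt ((ContinuousMap.norm_le _ (norm_nonneg (z - γ p))).2 fun q => ?_)
        (mem_ball_iff_norm.1 hz)
      simp
    have h2 := (ContinuousMap.dist_lt_iff hc).1 (H h1) p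
    simpa [dist_eq_norm] using h2.le
  have hp : ‖h p‖ < δ := lt_of_le_of_lt (h.norm_coe_le_norm p) (by simpa using hh)
  have := (convex_ball (γ p) δ).norm_image_sub_le_of_norm_hasFDerivWithin_le'
    (f := f) (f' := fun z => f' z) (φ := f' (γ p)) (x := γ p) (y := γ p + h p)
    (fun z _ => (hf z).hasFDerivWithinAt) key (Metric.mem_ball_self hδ)
    (by simpa [mem_ball_iff_norm] using hp)
  rw [add_sub_cancel_left] at this
  calc _ = ‖f (γ p + h p) - f (γ p) - f' (γ p) (h p)‖ := by simp
    _ ≤ c * ‖h p‖ := this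
    _ ≤ c * ‖h‖ := by gcongr; exact h.norm_coe_le_norm p

/-- The derivative of superposition by `f` is superposition by `fderiv ℝ f` followed by a continuous
linear map, so induction on the order works if the target `G` is allowed to vary. Both spaces share
a universe so that `E →L[ℝ] G` is again an admissible target. -/
theorem contDiff_postcomp_nat {E : Type v} [NormedAddCommGroup E] [NormedSpace ℝ E] (k : ℕ) :
    ∀ {G : Type v} [NormedAddCommGroup G] [NormedSpace ℝ G] (f : C(E, G)),
      ContDiff ℝ ∞ f → ContDiff ℝ k (fun γ : C(K, E) => f.comp γ) := by
  induction k with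
  | zero =>
    intro G _ _ f _
    exact contDiff_zero.2 (ContinuousMap.continuous_postcomp f)
  | succ k ih =>
    intro G _ _ f hf
    obtain ⟨hd, hf'⟩ := contDiff_infty_iff_fderiv.1 hf
    let f' : C(E, E →L[ℝ] G) := ⟨fderiv ℝ f, hf'.continuous⟩
    refine contDiff_succ_iff_hasFDerivAt.2
      ⟨fun γ => pointwiseApply K E G (f'.comp γ), ?_, fun γ =>
        hasFDerivAt_postcomp f f' (fun x => (hd x).hasFDerivAt) γ⟩
    exact (pointwiseApply K E G).contDiff.comp (ih f' hf')

/-- The superposition operator of a smooth map is smooth. -/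
theorem contDiff_postcomp {E G : Type v} [NormedAddCommGroup E] [NormedSpace ℝ E]
    [NormedAddCommGroup G] [NormedSpace ℝ G] (f : C(E, G)) (hf : ContDiff ℝ ∞ f) :
    ContDiff ℝ ∞ (fun γ : C(K, E) => f.comp γ) :=
  contDiff_infty.2 fun k => contDiff_postcomp_nat k f hf

variable {E : Type v} [NormedAddCommGroup E] [NormedSpace ℝ E]

/-- The primitive vanishing at `0`, as a continuous linear operator on `C([0,1], E)`. -/
def primitive (E : Type*) [NormedAddCommGroup E] [NormedSpace ℝ E] :
    C(unitInterval, E) →L[ℝ] C(unitInterval, E) :=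
  LinearMap.mkContinuous
    { toFun := fun γ => ⟨fun r => ∫ q in (0 : ℝ)..r, Set.IccExtend zero_le_one γ q, by
        have : Continuous fun r : ℝ => ∫ q in (0 : ℝ)..r, Set.IccExtend zero_le_one γ q :=
          intervalIntegral.continuous_primitive
            (fun a b => (γ.continuous.Icc_extend').intervalIntegrable a b) 0
        exact this.comp continuous_subtype_val⟩
      map_add' := fun γ η => by
        ext r
        exact intervalIntegral.integral_add
          ((γ.continuous.Icc_extend').intervalIntegrable _ _)
          ((η.continuous.Icc_extend').intervalIntegrable _ _)
      map_smul' := fun c γ => by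
        ext r
        exact intervalIntegral.integral_smul c _ } 1
    (fun γ => by
      rw [one_mul, ContinuousMap.norm_le _ (norm_nonneg _)]
      intro r
      refine (intervalIntegral.norm_integral_le_of_norm_le_const (C := ‖γ‖)
        fun q _ => γ.norm_coe_le_norm _).trans ?_
      rw [sub_zero, abs_of_nonneg r.2.1]
      exact mul_le_of_le_one_right (norm_nonneg _) r.2.2)

theorem primitive_apply (γ : C(unitInterval, E)) (r : unitInterval) :
    primitive E γ r = ∫ q in (0 : ℝ)..r, Set.IccExtend zero_le_one γ q := rfl

end LocalFlow

/-! ### Smooth dependence on initial values, by the inverse function theorem. -/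

section SmoothDependence

universe v

/-- Smoothness of order `∞` at one point gives no common neighbourhood for all finite orders.
Invertibility of the derivative is an open condition, so the inverse function theorem applies at
every nearby point. -/
theorem exists_contDiffOn_local_inverse {F : Type*} [NormedAddCommGroup F] [NormedSpace ℝ F]
    [CompleteSpace F] {Ψ : F → F} (hΨ : ContDiff ℝ ∞ Ψ) {a : F} (L : F ≃L[ℝ] F)
    (hL : HasFDerivAt Ψ (L : F →L[ℝ] F) a) :
    ∃ e : OpenPartialHomeomorph F F, ⇑e = Ψ ∧ a ∈ e.source ∧
      ∃ V ∈ 𝓝 (Ψ a), V ⊆ e.target ∧ ContDiffOn ℝ ∞ e.symm V := by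
  have hn : (∞ : WithTop ℕ∞) ≠ 0 := by simp
  let e := (hΨ.contDiffAt (x := a)).toOpenPartialHomeomorph Ψ hL hn
  have he : ⇑e = Ψ := (hΨ.contDiffAt (x := a)).toOpenPartialHomeomorph_coe hL hn
  have ha : a ∈ e.source := (hΨ.contDiffAt (x := a)).mem_toOpenPartialHomeomorph_source hL hn
  have hopen : IsOpen {q | fderiv ℝ Ψ q ∈ Set.range ((↑) : (F ≃L[ℝ] F) → F →L[ℝ] F)} :=
    ContinuousLinearEquiv.isOpen.preimage (hΨ.continuous_fderiv hn)
  refine ⟨e, he, ha, e.target ∩ e.symm ⁻¹' _, (e.isOpen_inter_preimage_symm hopen).mem_nhds ?_,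
    Set.inter_subset_left, ?_⟩
  · rw [← he]
    refine ⟨e.map_source ha, ?_⟩
    simp only [Set.mem_preimage, e.left_inv ha]
    exact ⟨L, hL.fderiv.symm⟩
  · rintro y ⟨hy, L', hL'⟩
    refine (e.contDiffAt_symm (f₀' := L') hy ?_ ?_).contDiffWithinAt
    · rw [he, hL']
      exact (hΨ.differentiable hn _).hasFDerivAt
    · rw [he]; exact hΨ.contDiffAt

variable {E : Type v} [NormedAddCommGroup E] [NormedSpace ℝ E]

/-- Constant functions, as a continuous linear map. -/
def constCLM (E : Type*) [NormedAddCommGroup E] [NormedSpace ℝ E] :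
    E →L[ℝ] C(unitInterval, E) :=
  LinearMap.mkContinuous
    { toFun := fun x => ContinuousMap.const _ x
      map_add' := fun _ _ => rfl
      map_smul' := fun _ _ => rfl } 1
    (fun x => by
      rw [one_mul, ContinuousMap.norm_le _ (norm_nonneg _)]
      exact fun _ => le_rfl)

@[simp]
theorem constCLM_apply (x : E) (r : unitInterval) : constCLM E x r = x := rfl

/-- The map whose zero fibre over `(x, s)` consists of the integral curves `r ↦ γ r` of `s • f`
starting at `x`. -/
def flowMap (f : C(E, E)) (q : E × ℝ × C(unitInterval, E)) : E × ℝ × C(unitInterval, E) :=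
  (q.1, q.2.1, q.2.2 - constCLM E q.1 - q.2.1 • primitive E (f.comp q.2.2))

theorem contDiff_flowMap {f : C(E, E)} (hf : ContDiff ℝ ∞ f) : ContDiff ℝ ∞ (flowMap f) := by
  have h1 : ContDiff ℝ ∞ fun q : E × ℝ × C(unitInterval, E) => q.2.1 := by fun_prop
  have h2 : ContDiff ℝ ∞ fun q : E × ℝ × C(unitInterval, E) => q.2.2 := by fun_prop
  have h3 : ContDiff ℝ ∞ fun q : E × ℝ × C(unitInterval, E) => primitive E (f.comp q.2.2) :=
    (primitive E).contDiff.comp ((contDiff_postcomp f hf).comp h2)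
  have h4 : ContDiff ℝ ∞ fun q : E × ℝ × C(unitInterval, E) => constCLM E q.1 :=
    (constCLM E).contDiff.comp contDiff_fst
  exact contDiff_fst.prodMk (h1.prodMk ((h2.sub h4).sub (h1.smul h3)))

/-- The triangular equivalence `(a, b, c) ↦ (a, b, c - const a - b • η)`. -/
def shearEquiv (η : C(unitInterval, E)) :
    (E × ℝ × C(unitInterval, E)) ≃L[ℝ] (E × ℝ × C(unitInterval, E)) where
  toFun q := (q.1, q.2.1, q.2.2 - constCLM E q.1 - q.2.1 • η)
  invFun q := (q.1, q.2.1, q.2.2 + constCLM E q.1 + q.2.1 • η)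
  map_add' p q := by
    ext <;> simp [add_smul]
    abel
  map_smul' c q := by ext <;> simp [smul_sub, mul_smul]
  left_inv q := by
    ext <;> simp
    abel
  right_inv q := by
    ext <;> simp
    abel
  continuous_toFun := by fun_prop
  continuous_invFun := by fun_prop

/-- At time `0` the integral term is multiplied by zero, so its dependence on the curve does not
contribute. The derivative is therefore triangular with identity diagonal, and invertible. -/
theorem hasFDerivAt_flowMap {f : C(E, E)} (hf : ContDiff ℝ ∞ f) (x₀ : E) :
    HasFDerivAt (flowMap f)
      (shearEquiv (primitive E (f.comp (constCLM E x₀))) : _ →L[ℝ] E × ℝ × C(unitInterval, E))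
      (x₀, 0, constCLM E x₀) := by
  have h1 : HasFDerivAt (fun q : E × ℝ × C(unitInterval, E) => q.2.1)
      ((ContinuousLinearMap.fst ℝ ℝ C(unitInterval, E)).comp
        (ContinuousLinearMap.snd ℝ E (ℝ × C(unitInterval, E)))) (x₀, 0, constCLM E x₀) :=
    ((ContinuousLinearMap.fst ℝ ℝ C(unitInterval, E)).comp
      (ContinuousLinearMap.snd ℝ E (ℝ × C(unitInterval, E)))).hasFDerivAt
  have h2 : HasFDerivAt (fun q : E × ℝ × C(unitInterval, E) => q.2.2)
      ((ContinuousLinearMap.snd ℝ ℝ C(unitInterval, E)).comp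
        (ContinuousLinearMap.snd ℝ E (ℝ × C(unitInterval, E)))) (x₀, 0, constCLM E x₀) :=
    ((ContinuousLinearMap.snd ℝ ℝ C(unitInterval, E)).comp
      (ContinuousLinearMap.snd ℝ E (ℝ × C(unitInterval, E)))).hasFDerivAt
  have h3 : DifferentiableAt ℝ (fun q : E × ℝ × C(unitInterval, E) =>
      primitive E (f.comp q.2.2)) (x₀, 0, constCLM E x₀) :=
    ((primitive E).contDiff.comp ((contDiff_postcomp f hf).comp
      (by fun_prop : ContDiff ℝ ∞ fun q : E × ℝ × C(unitInterval, E) => q.2.2))).differentiable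
      (by simp) _
  have h4 : HasFDerivAt (fun q : E × ℝ × C(unitInterval, E) => constCLM E q.1)
      ((constCLM E).comp (ContinuousLinearMap.fst ℝ E (ℝ × C(unitInterval, E))))
      (x₀, 0, constCLM E x₀) :=
    ((constCLM E).comp (ContinuousLinearMap.fst ℝ E (ℝ × C(unitInterval, E)))).hasFDerivAt
  have := hasFDerivAt_fst.prodMk (h1.prodMk ((h2.sub h4).sub (h1.smul h3.hasFDerivAt)))
  refine this.congr_fderiv ?_
  ext q <;> simp [shearEquiv]

/-- Picard-Lindelöf with smooth dependence on the initial value. -/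
theorem exists_smooth_local_flow [CompleteSpace E] {f : E → E} (hf : ContDiff ℝ ∞ f) (x₀ : E) :
    ∃ ε > 0, ∃ r > 0, ∃ α : E × ℝ → E,
      ContDiffOn ℝ ∞ α (Metric.ball x₀ r ×ˢ Set.Ioo (-ε) ε) ∧
      ∀ x ∈ Metric.ball x₀ r, α (x, 0) = x ∧
        ∀ s ∈ Set.Ioo (-ε) ε, HasDerivAt (fun s => α (x, s)) (f (α (x, s))) s := by
  obtain ⟨ε₁, hε₁, a, r₁, _, _, hr₁, hpl⟩ :=
    IsPicardLindelof.of_contDiffAt_one ((hf.of_le (by simp)).contDiffAt (x := x₀) (n := 1))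
  obtain ⟨α, hα, hαc⟩ := (hpl 0).exists_forall_mem_closedBall_eq_hasDerivWithinAt_continuousOn
  simp only [zero_sub, zero_add] at hα hαc
  let F : C(E, E) := ⟨f, hf.continuous⟩
  obtain ⟨e, he, hmem, V, hV, hVt, hVs⟩ := exists_contDiffOn_local_inverse
    (contDiff_flowMap (f := F) hf) _ (hasFDerivAt_flowMap (f := F) hf x₀)
  have h0 : flowMap F (x₀, 0, constCLM E x₀) = (x₀, 0, 0) := by simp [flowMap]
  rw [h0] at hV
  -- small curves lie in the source of the local inverse
  obtain ⟨η, hη, hηs⟩ := Metric.mem_nhds_iff.1 (e.open_source.mem_nhds hmem)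
  obtain ⟨δ₁, hδ₁, hδ₁V⟩ := Metric.mem_nhds_iff.1 hV
  have hαx₀ : α (x₀, 0) = x₀ := (hα x₀ (Metric.mem_closedBall_self hr₁.le)).1
  have hαc0 : ContinuousAt α (x₀, 0) :=
    hαc.continuousAt (prod_mem_nhds (Metric.closedBall_mem_nhds _ hr₁)
      (Icc_mem_nhds (by linarith) hε₁))
  obtain ⟨δ₂, hδ₂, hδ₂α⟩ := Metric.continuousAt_iff.1 hαc0 (η / 2) (by positivity)
  rw [hαx₀] at hδ₂α
  set δ := min (min (min δ₁ δ₂) (min ε₁ r₁)) η with hδ_def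
  have hδ : 0 < δ := by
    have : (0 : ℝ) < r₁ := hr₁
    positivity
  have hδle1 : δ ≤ δ₁ := (min_le_left _ _).trans ((min_le_left _ _).trans (min_le_left _ _))
  have hδle2 : δ ≤ δ₂ := (min_le_left _ _).trans ((min_le_left _ _).trans (min_le_right _ _))
  have hδle3 : δ ≤ ε₁ := (min_le_left _ _).trans ((min_le_right _ _).trans (min_le_left _ _))
  have hδle4 : δ ≤ r₁ := (min_le_left _ _).trans ((min_le_right _ _).trans (min_le_right _ _))
  have hδle5 : δ ≤ η := min_le_right _ _
  have hderiv : ∀ x ∈ Metric.ball x₀ δ, ∀ s ∈ Set.Ioo (-δ) δ,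
      HasDerivAt (fun s => α (x, s)) (f (α (x, s))) s := by
    intro x hx s hs
    have hx' : x ∈ Metric.closedBall x₀ r₁ :=
      Metric.ball_subset_closedBall (Metric.ball_subset_ball hδle4 hx)
    exact ((hα x hx').2 s ⟨by linarith [hs.1], by linarith [hs.2]⟩).hasDerivAt
      (Icc_mem_nhds (by linarith [hs.1]) (by linarith [hs.2]))
  have hmul : ∀ s ∈ Set.Ioo (-δ) δ, ∀ q ∈ Set.Icc (0 : ℝ) 1, s * q ∈ Set.Ioo (-δ) δ := by
    intro s hs q hq
    have : |s * q| < δ := by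
      rw [abs_mul, abs_of_nonneg hq.1]
      exact lt_of_le_of_lt (mul_le_of_le_one_right (abs_nonneg _) hq.2) (abs_lt.2 hs)
    exact abs_lt.1 this
  refine ⟨δ, hδ, δ, hδ, α, ?_, fun x hx => ⟨(hα x (Metric.ball_subset_closedBall
    (Metric.ball_subset_ball hδle4 hx))).1, hderiv x hx⟩⟩
  -- The Picard–Lindelöf solution, rescaled to `[0, 1]`, is a zero of the last component of
  -- `flowMap`. It is small enough to be the one found by the local inverse; evaluation at `1` then
  -- transfers smoothness to `α`.
  have key : ∀ p ∈ Metric.ball x₀ δ ×ˢ Set.Ioo (-δ) δ,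
      α p = (e.symm (p.1, p.2, 0)).2.2 1 := by
    rintro ⟨x, s⟩ ⟨hx, hs⟩
    have hcontα : ∀ q ∈ Set.Icc (0 : ℝ) 1, ContinuousAt (fun q => α (x, s * q)) q := by
      intro q hq
      exact ContinuousAt.comp (f := fun q => s * q) (g := fun s => α (x, s))
        (hderiv x hx _ (hmul s hs q hq)).continuousAt (by fun_prop)
    let γ : C(unitInterval, E) := ⟨fun q => α (x, s * q), by
      have : ContinuousOn (fun q => α (x, s * q)) (Set.Icc 0 1) :=
        fun q hq => (hcontα q hq).continuousWithinAt
      exact continuousOn_iff_continuous_domRestrict.1 this⟩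
    have hγ : (x, s, γ) ∈ e.source := by
      apply hηs
      rw [Metric.mem_ball, Prod.dist_eq, Prod.dist_eq]
      refine max_lt (lt_of_lt_of_le hx hδle5) (max_lt ?_ ?_)
      · simpa [Real.dist_eq] using lt_of_lt_of_le (abs_lt.2 hs) hδle5
      · refine lt_of_le_of_lt ((ContinuousMap.dist_le (by positivity)).2 fun q => ?_)
          (half_lt_self hη)
        refine (hδ₂α ?_).le
        rw [Prod.dist_eq]
        refine max_lt (lt_of_lt_of_le hx hδle2) ?_
        simpa [Real.dist_eq] using lt_of_lt_of_le (abs_lt.2 (hmul s hs q q.2)) hδle2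
    have hflow : e (x, s, γ) = (x, s, 0) := by
      rw [he]
      simp only [flowMap, Prod.mk.injEq, true_and]
      ext r
      have hI : ∀ q ∈ Set.uIcc (0 : ℝ) r, HasDerivAt (fun q => α (x, s * q))
          (s • f (α (x, s * q))) q := by
        intro q hq
        rw [Set.uIcc_of_le r.2.1] at hq
        have hq' : q ∈ Set.Icc (0 : ℝ) 1 := ⟨hq.1, hq.2.trans r.2.2⟩
        exact HasDerivAt.scomp q (hderiv x hx _ (hmul s hs q hq'))
          (by simpa using (hasDerivAt_id q).const_mul s)
      have hcint : ContinuousOn (fun q => s • f (α (x, s * q))) (Set.uIcc (0 : ℝ) r) := by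
        intro q hq
        rw [Set.uIcc_of_le r.2.1] at hq
        have := hcontα q ⟨hq.1, hq.2.trans r.2.2⟩
        exact ((hf.continuous.continuousAt.comp this).const_smul s).continuousWithinAt
      have hint := intervalIntegral.integral_eq_sub_of_hasDerivAt hI hcint.intervalIntegrable
      rw [intervalIntegral.integral_smul] at hint
      have hext : primitive E (F.comp γ) r = ∫ q in (0 : ℝ)..r, f (α (x, s * q)) := by
        rw [primitive_apply]
        refine intervalIntegral.integral_congr fun q hq => ?_
        rw [Set.uIcc_of_le r.2.1] at hq
        simp only [Set.IccExtend_of_mem zero_le_one _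
          (show q ∈ Set.Icc (0 : ℝ) 1 from ⟨hq.1, hq.2.trans r.2.2⟩)]
        rfl
      have hx0 : α (x, 0) = x := (hα x (Metric.ball_subset_closedBall
        (Metric.ball_subset_ball hδle4 hx))).1
      simp only [ContinuousMap.sub_apply, ContinuousMap.smul_apply, hext, hint, constCLM_apply,
        mul_zero, hx0, ContinuousMap.zero_apply]
      exact sub_self _
    have := e.left_inv hγ
    rw [hflow] at this
    rw [this]
    change α (x, s) = α (x, s * ((1 : unitInterval) : ℝ))
    rw [Set.Icc.coe_one, mul_one]
  refine ContDiffOn.congr ?_ key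
  have hin : ContDiffOn ℝ ∞ (fun p : E × ℝ => e.symm (p.1, p.2, 0))
      (Metric.ball x₀ δ ×ˢ Set.Ioo (-δ) δ) := by
    refine hVs.comp (by fun_prop) fun p hp => hδ₁V ?_
    rw [Metric.mem_ball, Prod.dist_eq, Prod.dist_eq]
    refine max_lt (lt_of_lt_of_le hp.1 hδle1) (max_lt ?_ (by simpa using hδ₁))
    simpa [Real.dist_eq] using lt_of_lt_of_le (abs_lt.2 hp.2) hδle1
  exact ((ContinuousMap.evalCLM ℝ (1 : unitInterval)).contDiff.comp_contDiffOn
    hin.snd.snd)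

end SmoothDependence

/-! ### Local flows on the manifold, read in a chart. -/

section ManifoldFlow

variable {n : ℕ} {M : Type*} [TopologicalSpace M] [ChartedSpace (EuclideanSpace ℝ (Fin n)) M]
  [IsManifold (𝓡 n) ∞ M]

/-- A smooth vector field read in the chart at `p`. -/
def chartField (v : SmoothVectorField n M) (p : M) (y : EuclideanSpace ℝ (Fin n)) :
    EuclideanSpace ℝ (Fin n) :=
  VectorField.mpullback 𝓘(ℝ, EuclideanSpace ℝ (Fin n)) (𝓡 n) (extChartAt (𝓡 n) p).symm v y

theorem isInvertible_mfderiv_extChartAt_symm (p : M) {y : EuclideanSpace ℝ (Fin n)}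
    (hy : y ∈ (extChartAt (𝓡 n) p).target) :
    (mfderiv 𝓘(ℝ, EuclideanSpace ℝ (Fin n)) (𝓡 n) (extChartAt (𝓡 n) p).symm y).IsInvertible := by
  simpa [ModelWithCorners.range_eq_univ, mfderivWithin_univ] using
    isInvertible_mfderivWithin_extChartAt_symm hy

theorem contMDiffAt_extChartAt_symm (p : M) {y : EuclideanSpace ℝ (Fin n)}
    (hy : y ∈ (extChartAt (𝓡 n) p).target) :
    ContMDiffAt 𝓘(ℝ, EuclideanSpace ℝ (Fin n)) (𝓡 n) ∞ (extChartAt (𝓡 n) p).symm y :=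
  (contMDiffOn_extChartAt_symm p).contMDiffAt ((isOpen_extChartAt_target p).mem_nhds hy)

theorem contDiffOn_chartField (v : SmoothVectorField n M) (p : M) :
    ContDiffOn ℝ ∞ (chartField v p) (extChartAt (𝓡 n) p).target := by
  refine contMDiffOn_vectorSpace_iff_contDiffOn.1 fun y hy => ContMDiffAt.contMDiffWithinAt ?_
  exact ContMDiffAt.mpullback_vectorField_preimage (n := ∞) (v.contMDiff _)
    (contMDiffAt_extChartAt_symm p hy) (isInvertible_mfderiv_extChartAt_symm p hy) (by simp)

theorem mfderiv_symm_chartField (v : SmoothVectorField n M) (p : M)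
    {y : EuclideanSpace ℝ (Fin n)} (hy : y ∈ (extChartAt (𝓡 n) p).target) :
    mfderiv 𝓘(ℝ, EuclideanSpace ℝ (Fin n)) (𝓡 n) (extChartAt (𝓡 n) p).symm y
      (chartField v p y) = v ((extChartAt (𝓡 n) p).symm y) :=
  (isInvertible_mfderiv_extChartAt_symm p hy).self_apply_inverse _

/-- Every smooth vector field has a smooth local flow near every point. -/
theorem exists_local_flow (v : SmoothVectorField n M) (p : M) :
    ∃ ε > 0, ∃ U ∈ 𝓝 p, ∃ φ : ℝ × M → M,
      ContMDiffOn (𝓘(ℝ, ℝ).prod (𝓡 n)) (𝓡 n) ∞ φ (Set.Ioo (-ε) ε ×ˢ U) ∧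
      ∀ x ∈ U, φ (0, x) = x ∧ IsMIntegralCurveOn (fun s => φ (s, x)) v (Set.Ioo (-ε) ε) := by
  set c := extChartAt (𝓡 n) p with hc
  have htarget : c.target ∈ 𝓝 (c p) := extChartAt_target_mem_nhds p
  obtain ⟨ρ, hρ, hρt⟩ := Metric.mem_nhds_iff.1 htarget
  -- The cutoff makes the chart field globally smooth; for short times the flow stays in the ball of
  -- radius `ρ / 3`, where the field is unchanged.
  let χ : ContDiffBump (c p) := ⟨ρ / 3, ρ / 2, by positivity, by linarith⟩
  have hχs : tsupport χ ⊆ c.target := by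
    rw [χ.tsupport_eq]
    exact (Metric.closedBall_subset_ball (half_lt_self hρ)).trans hρt
  let f : EuclideanSpace ℝ (Fin n) → EuclideanSpace ℝ (Fin n) := fun y => χ y • chartField v p y
  have hf : ContDiff ℝ ∞ f := by
    rw [contDiff_iff_contDiffAt]
    intro y
    by_cases hy : y ∈ tsupport χ
    · exact χ.contDiffAt.smul ((contDiffOn_chartField v p).contDiffAt
        ((isOpen_extChartAt_target p).mem_nhds (hχs hy)))
    · refine (contDiffAt_const (c := (0 : EuclideanSpace ℝ (Fin n)))).congr_of_eventuallyEq ?_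
      filter_upwards [(isClosed_tsupport χ).isOpen_compl.mem_nhds hy] with z hz
      simp [f, image_eq_zero_of_notMem_tsupport hz]
  obtain ⟨ε, hε, r, hr, α, hα, hflow⟩ := exists_smooth_local_flow hf (c p)
  have hα0 : α (c p, 0) = c p := (hflow _ (Metric.mem_ball_self hr)).1
  have hαc : ContinuousAt α (c p, 0) := hα.continuousOn.continuousAt
    (prod_mem_nhds (Metric.ball_mem_nhds _ hr) (Ioo_mem_nhds (by linarith) hε))
  have hball : Metric.ball (c p) (ρ / 3) ∈ 𝓝 (α (c p, 0)) := by
    rw [hα0]; exact Metric.ball_mem_nhds _ (by positivity)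
  obtain ⟨δ, hδ, hδα⟩ := Metric.mem_nhds_iff.1 (hαc hball)
  set ε' := min ε δ with hε'
  have hε'0 : 0 < ε' := lt_min hε hδ
  set r' := min r δ with hr'
  have hr'0 : 0 < r' := lt_min hr hδ
  have hmem : ∀ y ∈ Metric.ball (c p) r', ∀ s ∈ Set.Ioo (-ε') ε',
      α (y, s) ∈ Metric.ball (c p) (ρ / 3) := by
    intro y hy s hs
    apply hδα
    rw [Metric.mem_ball, Prod.dist_eq]
    refine max_lt (lt_of_lt_of_le hy (min_le_right _ _)) ?_
    simpa [Real.dist_eq] using lt_of_lt_of_le (abs_lt.2 hs) (min_le_right _ _)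
  have hsub : Metric.ball (c p) (ρ / 3) ⊆ c.target :=
    (Metric.ball_subset_ball (by linarith)).trans hρt
  let U : Set M := c.source ∩ c ⁻¹' Metric.ball (c p) r'
  have hU : U ∈ 𝓝 p := inter_mem (extChartAt_source_mem_nhds p)
    ((continuousAt_extChartAt p) (Metric.ball_mem_nhds _ hr'0))
  refine ⟨ε', hε'0, U, hU, fun q => c.symm (α (c q.2, q.1)), ?_, ?_⟩
  · refine ContMDiffOn.comp (contMDiffOn_extChartAt_symm p) (t := c.target)
      (f := fun q : ℝ × M => α (c q.2, q.1)) ?_ ?_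
    · have h1 : ContMDiffOn (𝓘(ℝ, ℝ).prod (𝓡 n)) 𝓘(ℝ, EuclideanSpace ℝ (Fin n)) ∞
          (fun q : ℝ × M => c q.2) (Set.Ioo (-ε') ε' ×ˢ U) :=
        (contMDiffOn_extChartAt (x := p)).comp contMDiffOn_snd
          (fun q hq => by simpa [c] using hq.2.1)
      have h2 : ContMDiffOn (𝓘(ℝ, ℝ).prod (𝓡 n)) 𝓘(ℝ, EuclideanSpace ℝ (Fin n) × ℝ) ∞
          (fun q : ℝ × M => (c q.2, q.1)) (Set.Ioo (-ε') ε' ×ˢ U) :=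
        h1.prodMk_space contMDiffOn_fst
      refine hα.contMDiffOn.comp h2 fun q hq => ⟨?_, ?_⟩
      · exact Metric.ball_subset_ball (min_le_left _ _) hq.2.2
      · exact Set.Ioo_subset_Ioo (neg_le_neg (min_le_left _ _)) (min_le_left _ _) hq.1
    · exact fun q hq => hsub (hmem _ hq.2.2 _ hq.1)
  · intro x hx
    have hxr : c x ∈ Metric.ball (c p) r := Metric.ball_subset_ball (min_le_left _ _) hx.2
    refine ⟨by simp only [(hflow _ hxr).1]; exact c.left_inv hx.1, fun s hs => ?_⟩
    have hs' : s ∈ Set.Ioo (-ε) ε :=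
      Set.Ioo_subset_Ioo (neg_le_neg (min_le_left _ _)) (min_le_left _ _) hs
    have hy := hmem _ hx.2 _ hs
    have hd := (hflow _ hxr).2 s hs'
    have hfy : f (α (c x, s)) = chartField v p (α (c x, s)) := by
      simp only [f]
      rw [χ.one_of_mem_closedBall (Metric.ball_subset_closedBall hy), one_smul]
    rw [hfy] at hd
    have hsymm := (contMDiffAt_extChartAt_symm p (hsub hy)).mdifferentiableAt (by simp)
    have := hsymm.hasMFDerivAt.comp s hd.hasFDerivAt.hasMFDerivAt
    refine HasMFDerivAt.hasMFDerivWithinAt ?_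
    refine this.congr_mfderiv ?_
    ext
    exact (congrArg (mfderiv 𝓘(ℝ, EuclideanSpace ℝ (Fin n)) (𝓡 n) c.symm (α (c x, s)))
      (one_smul ℝ (chartField v p (α (c x, s))))).trans
      ((mfderiv_symm_chartField v p (hsub hy)).trans (one_smul ℝ _).symm)

end ManifoldFlow

/-! ### Global flows of complete fields. -/

section GlobalFlow

variable {n : ℕ} {M : Type*} [TopologicalSpace M] [ChartedSpace (EuclideanSpace ℝ (Fin n)) M]
  [IsManifold (𝓡 n) ∞ M]

theorem contMDiff_one (v : SmoothVectorField n M) :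
    ContMDiff (𝓡 n) (𝓡 n).tangent 1 (fun x => (⟨x, v x⟩ : TangentBundle (𝓡 n) M)) :=
  v.contMDiff.of_le (by simp)

variable [T2Space M]

/-- A vector field with complete integral curves has a smooth global flow. -/
theorem exists_global_flow (v : SmoothVectorField n M)
    (hv : ∀ x, ∃ γ : ℝ → M, γ 0 = x ∧ IsMIntegralCurve γ v) :
    ∃ φ : ℝ × M → M, ContMDiff (𝓘(ℝ, ℝ).prod (𝓡 n)) (𝓡 n) ∞ φ ∧ (∀ x, φ (0, x) = x) ∧
      (∀ x, IsMIntegralCurve (fun s => φ (s, x)) v) ∧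
      ∀ s s' x, φ (s + s', x) = φ (s, φ (s', x)) := by
  choose γ hγ0 hγ using hv
  have hgroup : ∀ s s' x, γ x (s + s') = γ (γ x s') s := by
    intro s s' x
    have h1 : IsMIntegralCurve (γ x ∘ (· + s')) v := (hγ x).comp_add s'
    have := isMIntegralCurve_Ioo_eq_of_contMDiff_boundaryless (t₀ := 0) (contMDiff_one v) h1
      (hγ (γ x s')) (by simp [hγ0])
    exact congrFun this s
  let φ : ℝ × M → M := fun q => γ q.2 q.1
  have hlocal : ∀ q : M, ∃ ε > 0, ∃ U ∈ 𝓝 q,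
      ContMDiffOn (𝓘(ℝ, ℝ).prod (𝓡 n)) (𝓡 n) ∞ φ (Set.Ioo (-ε) ε ×ˢ U) := by
    intro q
    obtain ⟨ε, hε, U, hU, φ', hφ', hφ'U⟩ := exists_local_flow v q
    refine ⟨ε, hε, U, hU, hφ'.congr ?_⟩
    rintro ⟨s, x⟩ ⟨hs, hx⟩
    exact isMIntegralCurveOn_Ioo_eqOn_of_contMDiff_boundaryless (t₀ := 0)
      ⟨by linarith, hε⟩ (contMDiff_one v) ((hγ x).isMIntegralCurveOn _) (hφ'U x hx).2
      (by simp [hγ0, (hφ'U x hx).1]) hs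
  -- By the group law `φ (s₂, x) = φ (s₂ - s₁, φ (s₁, x))`, smoothness passes between any two times
  -- near `s₀`, so the times at which `φ` is smooth form a clopen set.
  have hstep : ∀ (x₀ : M) (s₀ : ℝ), ∃ δ > 0, ∀ s₁ s₂, |s₁ - s₀| < δ → |s₂ - s₀| < δ →
      ContMDiffAt (𝓘(ℝ, ℝ).prod (𝓡 n)) (𝓡 n) ∞ φ (s₁, x₀) →
      ContMDiffAt (𝓘(ℝ, ℝ).prod (𝓡 n)) (𝓡 n) ∞ φ (s₂, x₀) := by
    intro x₀ s₀
    obtain ⟨ε, hε, U, hU, hφU⟩ := hlocal (γ x₀ s₀)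
    obtain ⟨V, hVU, hVo, hV⟩ := mem_nhds_iff.1 hU
    obtain ⟨δ, hδ, hδV⟩ := Metric.mem_nhds_iff.1
      ((hγ x₀).continuous.continuousAt (hVo.mem_nhds hV))
    refine ⟨min δ (ε / 2), lt_min hδ (by positivity), fun s₁ s₂ h₁ h₂ hs₁ => ?_⟩
    have hx₁ : γ x₀ s₁ ∈ V :=
      hδV (by simpa [Real.dist_eq] using lt_of_lt_of_le h₁ (min_le_left _ _))
    have hs : s₂ - s₁ ∈ Set.Ioo (-ε) ε := by
      have h₁' := abs_lt.1 (lt_of_lt_of_le h₁ (min_le_right _ _))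
      have h₂' := abs_lt.1 (lt_of_lt_of_le h₂ (min_le_right _ _))
      constructor <;> linarith [h₁'.1, h₁'.2, h₂'.1, h₂'.2]
    have hout : ContMDiffAt (𝓘(ℝ, ℝ).prod (𝓡 n)) (𝓡 n) ∞ φ (s₂ - s₁, γ x₀ s₁) :=
      (hφU.contMDiffAt (prod_mem_nhds (Ioo_mem_nhds hs.1 hs.2)
        (Filter.mem_of_superset (hVo.mem_nhds hx₁) hVU)))
    have hin1 : ContMDiffAt (𝓘(ℝ, ℝ).prod (𝓡 n)) (𝓡 n) ∞ (fun q : ℝ × M => φ (s₁, q.2))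
        (s₂, x₀) :=
      ContMDiffAt.comp (g := φ) (f := fun q : ℝ × M => (s₁, q.2)) (s₂, x₀) hs₁
        (contMDiffAt_const.prodMk contMDiffAt_snd)
    have hin2 : ContMDiffAt (𝓘(ℝ, ℝ).prod (𝓡 n)) 𝓘(ℝ, ℝ) ∞ (fun q : ℝ × M => q.1 - s₁)
        (s₂, x₀) :=
      contMDiffAt_fst.sub contMDiffAt_const
    have hcomp := ContMDiffAt.comp (g := φ) (f := fun q : ℝ × M => (q.1 - s₁, φ (s₁, q.2)))
      (s₂, x₀) hout (hin2.prodMk hin1)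
    refine hcomp.congr_of_eventuallyEq (Eventually.of_forall fun q => ?_)
    change γ q.2 q.1 = γ (γ q.2 s₁) (q.1 - s₁)
    rw [← hgroup, sub_add_cancel]
  refine ⟨φ, ?_, hγ0, hγ, hgroup⟩
  rintro ⟨s, x₀⟩
  let A : Set ℝ := {s | ContMDiffAt (𝓘(ℝ, ℝ).prod (𝓡 n)) (𝓡 n) ∞ φ (s, x₀)}
  have hA : IsClopen A := by
    constructor
    · rw [← isOpen_compl_iff, Metric.isOpen_iff]
      intro s₀ hs₀
      obtain ⟨δ, hδ, h⟩ := hstep x₀ s₀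
      exact ⟨δ, hδ, fun s₁ hs₁ hA => hs₀ (h s₁ s₀ hs₁ (by simpa using hδ) hA)⟩
    · rw [Metric.isOpen_iff]
      intro s₀ hs₀
      obtain ⟨δ, hδ, h⟩ := hstep x₀ s₀
      exact ⟨δ, hδ, fun s₁ hs₁ => h s₀ s₁ (by simpa using hδ) hs₁ hs₀⟩
  have h0 : (0 : ℝ) ∈ A := by
    obtain ⟨ε, hε, U, hU, hφU⟩ := hlocal x₀
    exact hφU.contMDiffAt (prod_mem_nhds (Ioo_mem_nhds (by linarith) hε) hU)
  have : s ∈ A := by rw [hA.eq_univ ⟨0, h0⟩]; trivial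
  exact this

/-- A vector field vanishing outside a compact set is complete. -/
theorem exists_isMIntegralCurve_of_compact (v : SmoothVectorField n M) {K : Set M}
    (hK : IsCompact K) (hv : ∀ x ∉ K, v x = 0) (x : M) :
    ∃ γ : ℝ → M, γ 0 = x ∧ IsMIntegralCurve γ v := by
  have hunif : ∃ ε > 0, ∀ x ∈ K, ∃ γ : ℝ → M, γ 0 = x ∧
      IsMIntegralCurveOn γ v (Set.Ioo (-ε) ε) := by
    refine hK.induction_on (p := fun s => ∃ ε > 0, ∀ x ∈ s, ∃ γ : ℝ → M, γ 0 = x ∧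
      IsMIntegralCurveOn γ v (Set.Ioo (-ε) ε)) ⟨1, one_pos, fun _ h => h.elim⟩ ?_ ?_ ?_
    · rintro s s' hs ⟨ε, hε, h⟩
      exact ⟨ε, hε, fun x hx => h x (hs hx)⟩
    · rintro s s' ⟨ε, hε, h⟩ ⟨ε', hε', h'⟩
      refine ⟨min ε ε', lt_min hε hε', ?_⟩
      rintro x (hx | hx)
      · obtain ⟨γ, h0, hγ⟩ := h x hx
        exact ⟨γ, h0, hγ.mono (Set.Ioo_subset_Ioo (neg_le_neg (min_le_left _ _)) (min_le_left _ _))⟩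
      · obtain ⟨γ, h0, hγ⟩ := h' x hx
        exact ⟨γ, h0, hγ.mono
          (Set.Ioo_subset_Ioo (neg_le_neg (min_le_right _ _)) (min_le_right _ _))⟩
    · intro p _
      obtain ⟨ε, hε, U, hU, φ, -, hφ⟩ := exists_local_flow v p
      exact ⟨U, mem_nhdsWithin_of_mem_nhds hU, ε, hε, fun x hx => ⟨fun s => φ (s, x), hφ x hx⟩⟩
  obtain ⟨ε, hε, h⟩ := hunif
  refine exists_isMIntegralCurve_of_isMIntegralCurveOn (contMDiff_one v) hε (fun x => ?_) x
  by_cases hx : x ∈ K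
  · exact h x hx
  · exact ⟨fun _ => x, rfl, (isMIntegralCurve_const (hv x hx)).isMIntegralCurveOn _⟩

end GlobalFlow

/-! ### Derivations, brackets and the commutator identity. -/

section Calculus

variable {n : ℕ} {M : Type*} [TopologicalSpace M] [ChartedSpace (EuclideanSpace ℝ (Fin n)) M]

theorem mdifferentiableAt_function (f : C^∞⟮𝓡 n, M; ℝ⟯) (x : M) :
    MDifferentiableAt (𝓡 n) 𝓘(ℝ, ℝ) f x :=
  f.contMDiff.mdifferentiable (by simp) x

variable [IsManifold (𝓡 n) ∞ M]

theorem fieldDeriv_congr (Z : SmoothVectorField n M) {f g : M → ℝ} {x : M} (h : f =ᶠ[𝓝 x] g) :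
    fieldDeriv Z f x = fieldDeriv Z g x := by
  simp only [fieldDeriv, mvfderiv]
  rw [h.mfderiv_eq]
  rfl

theorem fieldDeriv_const (Z : SmoothVectorField n M) (c : ℝ) (x : M) :
    fieldDeriv Z (fun _ => c) x = 0 := by
  simp [fieldDeriv, mvfderiv_const]

theorem fieldDeriv_eq_zero_of_eventually_const (Z : SmoothVectorField n M) {f : M → ℝ} {c : ℝ}
    {x : M} (h : ∀ᶠ y in 𝓝 x, f y = c) : fieldDeriv Z f x = 0 :=
  (fieldDeriv_congr Z h).trans (fieldDeriv_const Z c x)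

theorem fieldDeriv_fun_add (Z : SmoothVectorField n M) {f g : M → ℝ} {x : M}
    (hf : MDifferentiableAt (𝓡 n) 𝓘(ℝ, ℝ) f x) (hg : MDifferentiableAt (𝓡 n) 𝓘(ℝ, ℝ) g x) :
    fieldDeriv Z (fun y => f y + g y) x = fieldDeriv Z f x + fieldDeriv Z g x := by
  change mvfderiv (𝓡 n) (f + g) x (Z x) = _
  rw [mvfderiv_add hf hg]
  rfl

theorem fieldDeriv_fun_mul (Z : SmoothVectorField n M) {f g : M → ℝ} {x : M}
    (hf : MDifferentiableAt (𝓡 n) 𝓘(ℝ, ℝ) f x) (hg : MDifferentiableAt (𝓡 n) 𝓘(ℝ, ℝ) g x) :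
    fieldDeriv Z (fun y => f y * g y) x
      = fieldDeriv Z f x * g x + f x * fieldDeriv Z g x := by
  change mvfderiv (𝓡 n) (f * g) x (Z x) = _
  rw [mvfderiv_mul hf hg]
  simp only [add_apply, smul_apply, smul_eq_mul, fieldDeriv]
  ring

theorem fieldDeriv_comp (Z : SmoothVectorField n M) {h : ℝ → ℝ} {h' : ℝ} {f : M → ℝ} {x : M}
    (hh : HasDerivAt h h' (f x)) (hf : MDifferentiableAt (𝓡 n) 𝓘(ℝ, ℝ) f x) :
    fieldDeriv Z (fun y => h (f y)) x = h' * fieldDeriv Z f x := by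
  have h1 := (hh.hasFDerivAt.hasMFDerivAt.comp x hf.hasMFDerivAt).mfderiv
  change (mfderiv (𝓡 n) 𝓘(ℝ, ℝ) (h ∘ f) x) (Z x) = _
  rw [h1]
  exact mul_comm (fieldDeriv Z f x) h'

theorem fieldDeriv_fun_sum (Z : SmoothVectorField n M) {ι : Type*} (s : Finset ι)
    {f : ι → M → ℝ} {x : M} (hf : ∀ i ∈ s, MDifferentiableAt (𝓡 n) 𝓘(ℝ, ℝ) (f i) x) :
    fieldDeriv Z (fun y => ∑ i ∈ s, f i y) x = ∑ i ∈ s, fieldDeriv Z (f i) x := by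
  classical
  have hmd : ∀ t ⊆ s, MDifferentiableAt (𝓡 n) 𝓘(ℝ, ℝ) (fun y => ∑ i ∈ t, f i y) x := by
    intro t
    induction t using Finset.induction_on with
    | empty => intro _; simpa using mdifferentiableAt_const
    | insert a t ha ih =>
      intro hts
      simp only [Finset.sum_insert ha]
      exact (hf a (hts (Finset.mem_insert_self _ _))).add
        (ih ((Finset.subset_insert _ _).trans hts))
  induction s using Finset.induction_on with
  | empty => simpa using fieldDeriv_const Z 0 x
  | insert a t ha ih =>
    simp only [Finset.sum_insert ha]
    rw [fieldDeriv_fun_add Z (hf a (Finset.mem_insert_self _ _)) (hmd t (Finset.subset_insert _ _)),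
      ih (fun i hi => hf i (Finset.mem_insert_of_mem hi))
        (fun u hu => hmd u (hu.trans (Finset.subset_insert _ _)))]

/-- The product of a smooth function and a smooth vector field. -/
def smulField (f : C^∞⟮𝓡 n, M; ℝ⟯) (Z : SmoothVectorField n M) : SmoothVectorField n M :=
  ⟨fun x => f x • Z x, f.contMDiff.smul_section Z.contMDiff⟩

@[simp]
theorem smulField_apply (f : C^∞⟮𝓡 n, M; ℝ⟯) (Z : SmoothVectorField n M) (x : M) :
    smulField f Z x = f x • Z x := rfl

theorem minSmoothness_le_infty (k : ℕ) : minSmoothness ℝ k ≤ ∞ := by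
  rw [minSmoothness_of_isRCLikeNormedField]
  exact WithTop.coe_le_coe.2 (le_top : (k : ℕ∞) ≤ ⊤)

instance isManifold_minSmoothness_three : IsManifold (𝓡 n) (minSmoothness ℝ 3) M :=
  IsManifold.of_le (n := ∞) (minSmoothness_le_infty 3)

/-- The Lie bracket of smooth vector fields. -/
def bracketField (Z W : SmoothVectorField n M) : SmoothVectorField n M :=
  ⟨VectorField.mlieBracket (𝓡 n) Z W, by
    have : IsManifold (𝓡 n) (((⊤ : ℕ∞) : WithTop ℕ∞) + 1) M :=
      (inferInstance : IsManifold (𝓡 n) ∞ M)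
    exact fun x => (Z.contMDiff x).mlieBracket_vectorField (m := ⊤) (n := ⊤) (W.contMDiff x)
      (by simp)⟩

theorem bracketField_apply (Z W : SmoothVectorField n M) (x : M) :
    bracketField Z W x = VectorField.mlieBracket (𝓡 n) Z W x := rfl

theorem fieldDeriv_add_field (Z W : SmoothVectorField n M) (f : M → ℝ) (x : M) :
    fieldDeriv (Z + W) f x = fieldDeriv Z f x + fieldDeriv W f x :=
  map_add (mvfderiv (𝓡 n) f x) (Z x) (W x)

theorem mdifferentiableAt_field (Z : SmoothVectorField n M) (x : M) :
    MDifferentiableAt (𝓡 n) (𝓡 n).tangent (fun x => (Z x : TangentBundle (𝓡 n) M)) x :=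
  Z.mdifferentiable x

theorem bracketField_add_right (Z W W' : SmoothVectorField n M) :
    bracketField Z (W + W') = bracketField Z W + bracketField Z W' := by
  ext1 x
  exact VectorField.mlieBracket_add_right (mdifferentiableAt_field W x)
    (mdifferentiableAt_field W' x)

theorem bracketField_swap (Z W : SmoothVectorField n M) :
    bracketField Z W = - bracketField W Z := by
  ext1 x
  exact VectorField.mlieBracket_swap_apply

theorem bracketField_smul_right (Z W : SmoothVectorField n M) (f : C^∞⟮𝓡 n, M; ℝ⟯) :
    bracketField Z (smulField f W)
      = smulField (fieldOperator Z f) W + smulField f (bracketField Z W) := by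
  ext1 x
  exact VectorField.mlieBracket_smul_right (mdifferentiableAt_function f x)
    (mdifferentiableAt_field W x)

theorem bracketField_jacobi (U V W : SmoothVectorField n M) :
    bracketField U (bracketField V W)
      = bracketField (bracketField U V) W + bracketField V (bracketField U W) := by
  ext1 x
  have h2 : minSmoothness ℝ 2 ≤ ∞ := minSmoothness_le_infty 2
  exact VectorField.leibniz_identity_mlieBracket_apply ((U.contMDiff x).of_le h2)
    ((V.contMDiff x).of_le h2) ((W.contMDiff x).of_le h2)

theorem bracketField_eq_zero_of_eq_zero {Z W : SmoothVectorField n M} {x : M} (hZ : Z x = 0)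
    (hW : W x = 0) : bracketField Z W x = 0 := by
  rw [bracketField_apply, ← VectorField.mlieBracketWithin_univ]
  exact VectorField.mlieBracketWithin_eq_zero_of_eq_zero hZ hW

/-- The Lie bracket acts on functions as the commutator. -/
theorem fieldOperator_bracketField (Z W : SmoothVectorField n M) (f : C^∞⟮𝓡 n, M; ℝ⟯) :
    fieldOperator (bracketField Z W) f
      = fieldOperator Z (fieldOperator W f) - fieldOperator W (fieldOperator Z f) := by
  -- The Jacobi identity for `Z`, `W`, `f U`, minus `f` times the one for `Z`, `W`, `U`, leaves
  -- exactly the commutator identity multiplied by `U`.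
  have key : ∀ U : SmoothVectorField n M, smulField (fieldOperator (bracketField Z W) f) U
      = smulField (fieldOperator Z (fieldOperator W f) - fieldOperator W (fieldOperator Z f)) U := by
    intro U
    have h := bracketField_jacobi Z W (smulField f U)
    have hU := bracketField_jacobi Z W U
    simp only [bracketField_smul_right, bracketField_add_right] at h
    ext1 x
    have hx := congrArg (fun S : SmoothVectorField n M => S x) h
    have hUx := congrArg (fun S : SmoothVectorField n M => S x) hU
    simp only [ContMDiffSection.coe_add, Pi.add_apply, smulField_apply] at hx hUx
    rw [hUx, smul_add] at hx
    simp only [smulField_apply, ContMDiffMap.coe_sub, Pi.sub_apply, sub_smul]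
    rw [eq_sub_iff_add_eq]
    linear_combination (norm := module) (-1 : ℝ) • hx
  ext x
  -- To cancel `U` at `x`, take `U` to be `Z` or `W`, whichever is nonzero there; if both vanish, so
  -- does their bracket.
  by_cases hZ : Z x = 0
  · by_cases hW : W x = 0
    · change mvfderiv (𝓡 n) f x (bracketField Z W x)
        = mvfderiv (𝓡 n) _ x (Z x) - mvfderiv (𝓡 n) _ x (W x)
      rw [bracketField_eq_zero_of_eq_zero hZ hW, hZ, hW]
      simp
    · exact smul_left_injective ℝ hW (congrArg (fun S : SmoothVectorField n M => S x) (key W))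
  · exact smul_left_injective ℝ hZ (congrArg (fun S : SmoothVectorField n M => S x) (key Z))

end Calculus

/-! ### Maximum principle and boundedness of solutions of decaying linear systems. -/

section MaximumPrinciple

variable {n : ℕ} {M : Type*} [TopologicalSpace M]

/-- A function all of whose sublevel sets are compact. -/
def IsExhausting (τ : M → ℝ) : Prop := ∀ S : ℝ, IsCompact {x | τ x ≤ S}

theorem IsExhausting.eventually_iff {τ : M → ℝ} (hτ : IsExhausting τ) (hc : Continuous τ)
    {P : M → Prop} : (∀ᶠ x in cocompact M, P x) ↔ ∃ a : ℝ, ∀ x, a < τ x → P x := by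
  constructor
  · intro h
    obtain ⟨K, hK, hKP⟩ := mem_cocompact.1 h
    obtain ⟨a, ha⟩ := (hK.image hc).bddAbove
    exact ⟨a, fun x hx => hKP fun hxK => absurd (ha ⟨x, hxK, rfl⟩) (not_le.2 hx)⟩
  · rintro ⟨a, ha⟩
    exact mem_cocompact.2 ⟨_, hτ a, fun x hx => ha x (not_le.1 hx)⟩

variable [ChartedSpace (EuclideanSpace ℝ (Fin n)) M]

/-- A smooth function which is bounded near infinity is bounded. -/
theorem exists_bound_of_eventually (f : C^∞⟮𝓡 n, M; ℝ⟯) {C : ℝ}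
    (h : ∀ᶠ x in cocompact M, |f x| ≤ C) : ∃ C, ∀ x, |f x| ≤ C := by
  obtain ⟨K, hK, hKC⟩ := mem_cocompact.1 h
  obtain ⟨C', hC'⟩ := (hK.image (f.contMDiff.continuous.abs)).bddAbove
  refine ⟨max C C', fun x => ?_⟩
  by_cases hx : x ∈ K
  · exact (hC' ⟨x, hx, rfl⟩).trans (le_max_right _ _)
  · exact (hKC hx : |f x| ≤ C).trans (le_max_left _ _)

variable [IsManifold (𝓡 n) ∞ M]

theorem hasDerivAt_comp_integralCurve {Z : SmoothVectorField n M} {γ : ℝ → M} {s : ℝ}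
    (hγ : HasMFDerivAt 𝓘(ℝ, ℝ) (𝓡 n) γ s ((1 : ℝ →L[ℝ] ℝ).smulRight (Z (γ s)))) {f : M → ℝ}
    (hf : MDifferentiableAt (𝓡 n) 𝓘(ℝ, ℝ) f (γ s)) :
    HasDerivAt (fun s => f (γ s)) (fieldDeriv Z f (γ s)) s := by
  let L : ℝ →L[ℝ] ℝ :=
    (mfderiv (𝓡 n) 𝓘(ℝ, ℝ) f (γ s)).comp ((1 : ℝ →L[ℝ] ℝ).smulRight (Z (γ s)))
  have h : HasFDerivAt (fun s => f (γ s)) L s := (hf.hasMFDerivAt.comp s hγ).hasFDerivAt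
  refine h.hasDerivAt.congr_deriv ?_
  exact congrArg (mfderiv (𝓡 n) 𝓘(ℝ, ℝ) f (γ s)) (one_smul ℝ (Z (γ s)))

theorem eventually_lt_of_hasDerivAt_neg {g : ℝ → ℝ} {c : ℝ} (hg : HasDerivAt g c 0) (hc : c < 0) :
    ∀ᶠ s in 𝓝[<] (0 : ℝ), g 0 < g s := by
  have h := (hasDerivAt_iff_tendsto_slope.1 hg).eventually (gt_mem_nhds hc)
  have h' : ∀ᶠ s in 𝓝[<] (0 : ℝ), slope g 0 s < 0 :=
    nhdsWithin_mono _ (fun s (hs : s < 0) => ne_of_lt hs) h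
  filter_upwards [h', self_mem_nhdsWithin] with s hs hs0
  rw [slope_def_field, sub_zero] at hs
  have hs0' : s < 0 := hs0
  rcases div_neg_iff.1 hs with h | h
  · linarith [h.1]
  · linarith [h.2]

/-- A function with nonpositive derivative along a field increasing `τ` at unit speed is bounded
above by its values on a level set. -/
theorem bddAbove_of_fieldDeriv_nonpos {τ : C^∞⟮𝓡 n, M; ℝ⟯} (hτ : IsExhausting τ)
    {Z : SmoothVectorField n M} {a : ℝ} (hZ : ∀ x, a < τ x → fieldDeriv Z τ x = 1) {H : M → ℝ}
    (hH : ∀ x, a < τ x → MDifferentiableAt (𝓡 n) 𝓘(ℝ, ℝ) H x)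
    (hZH : ∀ x, a < τ x → fieldDeriv Z H x ≤ 0) :
    ∃ C, ∀ x, a + 1 ≤ τ x → H x ≤ C := by
  have hτc : Continuous τ := τ.contMDiff.continuous
  have hcl : ∀ S, IsCompact {x | a + 1 ≤ τ x ∧ τ x ≤ S} := fun S =>
    ((hτ S).inter_left (isClosed_le continuous_const hτc))
  have hlevel : ∃ C, ∀ x, τ x = a + 1 → H x ≤ C := by
    have hcomp := hcl (a + 1)
    have hcont : ContinuousOn H {x | a + 1 ≤ τ x ∧ τ x ≤ a + 1} := fun x hx =>
      (hH x (by linarith [hx.1])).continuousAt.continuousWithinAt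
    obtain ⟨C, hC⟩ := (hcomp.image_of_continuousOn hcont).bddAbove
    exact ⟨C, fun x hx => hC ⟨x, ⟨hx.ge, hx.le⟩, rfl⟩⟩
  obtain ⟨C, hC⟩ := hlevel
  refine ⟨C, fun x hx => ?_⟩
  -- Maximise `H - δ τ` on the slab between the levels `a + 1` and `τ x`. Above the lower level,
  -- following `Z` backwards decreases `τ` and strictly increases `H - δ τ`, so the maximum lies on
  -- the lower level.
  have key : ∀ δ > 0, H x ≤ C + δ * (τ x - (a + 1)) := by
    intro δ hδ
    have hcont : ContinuousOn (fun y => H y - δ * τ y) {y | a + 1 ≤ τ y ∧ τ y ≤ τ x} :=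
      fun y hy => ((hH y (by linarith [hy.1])).continuousAt.sub
        (continuousAt_const.mul hτc.continuousAt)).continuousWithinAt
    obtain ⟨p, hp, hmax⟩ := (hcl (τ x)).exists_isMaxOn ⟨x, hx, le_rfl⟩ hcont
    have hxp : H x - δ * τ x ≤ H p - δ * τ p := hmax ⟨hx, le_rfl⟩
    rcases hp.1.eq_or_lt with h | h
    · have := hC p h.symm
      rw [← h] at hxp
      linarith
    · exfalso
      obtain ⟨γ, hγ0, hγ⟩ := exists_isMIntegralCurveAt_of_contMDiffAt_boundaryless (I := 𝓡 n)
        (t₀ := 0) ((contMDiff_one Z) p)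
      have hd := hγ.hasMFDerivAt
      have hap : a < τ p := by linarith
      have hHd := hasDerivAt_comp_integralCurve hd (f := H) (by rw [hγ0]; exact hH p hap)
      have hτd := hasDerivAt_comp_integralCurve hd (mdifferentiableAt_function τ (γ 0))
      rw [hγ0] at hHd hτd
      rw [hZ p hap] at hτd
      have h1 := eventually_lt_of_hasDerivAt_neg (g := fun s => H (γ s) - δ * τ (γ s))
        (hHd.sub (hτd.const_mul δ)) (by linarith [hZH p hap])
      have h2 := eventually_lt_of_hasDerivAt_neg (g := fun s => -τ (γ s)) hτd.neg (by norm_num)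
      have h3 : ∀ᶠ s in 𝓝[<] (0 : ℝ), a + 1 < τ (γ s) := by
        have : ContinuousAt (fun s => τ (γ s)) 0 := hτd.continuousAt
        exact nhdsWithin_le_nhds (this.eventually (lt_mem_nhds (by simpa [hγ0] using h)))
      obtain ⟨s, hs1, hs2, hs3⟩ := (h1.and (h2.and h3)).exists
      simp only [hγ0] at hs1 hs2
      have := hmax (show γ s ∈ _ from ⟨hs3.le, by linarith [hp.2]⟩)
      simp only [Set.mem_ofPred_eq] at this
      linarith
  refine le_of_forall_pos_le_add fun η hη => ?_
  refine (key (η / (τ x - a)) (by apply div_pos hη; linarith)).trans ?_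
  have : η / (τ x - a) * (τ x - (a + 1)) ≤ η := by
    rw [div_mul_eq_mul_div, div_le_iff₀ (by linarith)]
    nlinarith
  linarith

/-- Solutions of a linear system along `Z` with coefficients `O(τ ^ (-1 - ε))` are bounded. -/
theorem bounded_of_linear_system {τ : C^∞⟮𝓡 n, M; ℝ⟯} (hτ : IsExhausting τ)
    {Z : SmoothVectorField n M} (hZ : ∀ᶠ x in cocompact M, fieldDeriv Z τ x = 1)
    {ε : ℝ} (hε : 0 < ε) {ι : Type*} [Fintype ι] (g : ι → C^∞⟮𝓡 n, M; ℝ⟯) (A : ι → ι → M → ℝ)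
    (hA : ∀ i j, ∃ C, ∀ᶠ x in cocompact M, |A i j x| ≤ C * τ x ^ (-(1 + ε)))
    (hg : ∀ i, ∀ᶠ x in cocompact M, fieldDeriv Z (g i) x = ∑ j, A i j x * g j x) (i : ι) :
    ∃ C, ∀ x, |g i x| ≤ C := by
  have hτc : Continuous τ := τ.contMDiff.continuous
  choose C₀ hC₀ using hA
  set C : ℝ := ∑ i, ∑ j, |C₀ i j| with hCdef
  have hCle : ∀ i j, C₀ i j ≤ C := fun i j =>
    (le_abs_self _).trans ((Finset.single_le_sum (f := fun j => |C₀ i j|)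
      (fun _ _ => abs_nonneg _) (Finset.mem_univ j)).trans
      (Finset.single_le_sum (f := fun i => ∑ j, |C₀ i j|)
        (fun _ _ => Finset.sum_nonneg fun _ _ => abs_nonneg _) (Finset.mem_univ i)))
  have hev := hZ.and ((eventually_all.2 fun i => hg i).and
    (eventually_all.2 fun i => eventually_all.2 fun j => hC₀ i j))
  obtain ⟨a, ha⟩ := (hτ.eventually_iff hτc).1 hev
  set b := max a 1 with hb
  -- Summing `2 |g_i g_j| ≤ g_i² + g_j²` over all pairs gives `2 * card ι * G`, so `G` grows along
  -- `Z` at rate at most `K * τ ^ (-(1 + ε))`.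
  set K : ℝ := 2 * C * Fintype.card ι with hK
  have hCnn : 0 ≤ C := Finset.sum_nonneg fun _ _ => Finset.sum_nonneg fun _ _ => abs_nonneg _
  have hKnn : 0 ≤ K := by positivity
  let G : M → ℝ := fun x => ∑ i, g i x * g i x
  have hGnn : ∀ x, 0 ≤ G x := fun x => Finset.sum_nonneg fun i _ => mul_self_nonneg _
  have hGd : ∀ x, MDifferentiableAt (𝓡 n) 𝓘(ℝ, ℝ) G x := fun x =>
    ContMDiffAt.mdifferentiableAt (n := ∞)
      (contMDiffAt_finsetSum fun i _ => (g i).contMDiff.contMDiffAt.mul (g i).contMDiff.contMDiffAt)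
      (by simp)
  -- An integrating factor: its logarithmic derivative `-K r ^ (-(1 + ε))` offsets the growth of
  -- `G`. It is at least `1`, so a bound on `G * w` bounds `G`.
  let w : ℝ → ℝ := fun r => Real.exp (K / ε * r ^ (-ε))
  have hw : ∀ r, 0 < r → HasDerivAt w (w r * (-K * r ^ (-(1 + ε)))) r := by
    intro r hr
    have h1 := (Real.hasDerivAt_rpow_const (p := -ε) (Or.inl hr.ne')).const_mul (K / ε)
    refine h1.exp.congr_deriv ?_
    rw [show -ε - 1 = -(1 + ε) by ring]
    simp only [w]
    field_simp
  let H : M → ℝ := fun x => G x * w (τ x)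
  have hpos : ∀ x, b < τ x → 0 < τ x := fun x hx =>
    one_pos.trans_le ((le_max_right a 1).trans hx.le)
  have hwτ : ∀ x, b < τ x → MDifferentiableAt (𝓡 n) 𝓘(ℝ, ℝ) (fun y => w (τ y)) x := fun x hx =>
    (hw _ (hpos x hx)).differentiableAt.mdifferentiableAt.comp x (mdifferentiableAt_function τ x)
  have hH : ∀ x, b < τ x → MDifferentiableAt (𝓡 n) 𝓘(ℝ, ℝ) H x := fun x hx =>
    (hGd x).mul (hwτ x hx)
  have hZH : ∀ x, b < τ x → fieldDeriv Z H x ≤ 0 := by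
    intro x hx
    obtain ⟨h1, h2, h3⟩ := ha x ((le_max_left a 1).trans_lt hx)
    have hτpos := hpos x hx
    have hZG : fieldDeriv Z G x = ∑ i, 2 * (g i x * ∑ j, A i j x * g j x) := by
      rw [fieldDeriv_fun_sum Z Finset.univ (f := fun i y => g i y * g i y) (fun i _ =>
        (mdifferentiableAt_function (g i) x).mul (mdifferentiableAt_function (g i) x))]
      refine Finset.sum_congr rfl fun i _ => ?_
      rw [fieldDeriv_fun_mul Z (mdifferentiableAt_function (g i) x)
        (mdifferentiableAt_function (g i) x), h2 i]
      ring
    have hρ : 0 ≤ τ x ^ (-(1 + ε)) := (Real.rpow_pos_of_pos hτpos _).le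
    have hZGle : fieldDeriv Z G x ≤ K * τ x ^ (-(1 + ε)) * G x := by
      rw [hZG]
      have hterm : ∀ i j, 2 * (g i x * (A i j x * g j x))
          ≤ C * τ x ^ (-(1 + ε)) * (g i x * g i x + g j x * g j x) := by
        intro i j
        have hAij : |A i j x| ≤ C * τ x ^ (-(1 + ε)) :=
          (h3 i j).trans (mul_le_mul_of_nonneg_right (hCle i j) hρ)
        have h4 : 2 * (g i x * g j x) ≤ g i x * g i x + g j x * g j x := by
          nlinarith [sq_nonneg (g i x - g j x)]
        have h5 : -(2 * (g i x * g j x)) ≤ g i x * g i x + g j x * g j x := by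
          nlinarith [sq_nonneg (g i x + g j x)]
        calc 2 * (g i x * (A i j x * g j x)) = A i j x * (2 * (g i x * g j x)) := by ring
          _ ≤ |A i j x| * |2 * (g i x * g j x)| := by rw [← abs_mul]; exact le_abs_self _
          _ ≤ |A i j x| * (g i x * g i x + g j x * g j x) :=
              mul_le_mul_of_nonneg_left (abs_le.2 ⟨by linarith, h4⟩) (abs_nonneg _)
          _ ≤ _ := mul_le_mul_of_nonneg_right hAij
              (add_nonneg (mul_self_nonneg _) (mul_self_nonneg _))
      calc ∑ i, 2 * (g i x * ∑ j, A i j x * g j x)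
          = ∑ i, ∑ j, 2 * (g i x * (A i j x * g j x)) := by simp only [Finset.mul_sum]
        _ ≤ ∑ i, ∑ j, C * τ x ^ (-(1 + ε)) * (g i x * g i x + g j x * g j x) :=
            Finset.sum_le_sum fun i _ => Finset.sum_le_sum fun j _ => hterm i j
        _ = K * τ x ^ (-(1 + ε)) * G x := by
            simp only [← Finset.mul_sum, Finset.sum_add_distrib, Finset.sum_const,
              Finset.card_univ, nsmul_eq_mul, G, hK]
            simp only [mul_left_comm _ (Fintype.card ι : ℝ), ← Finset.mul_sum]
            ring
    rw [fieldDeriv_fun_mul Z (hGd x) (hwτ x hx),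
      fieldDeriv_comp Z (hw _ hτpos) (mdifferentiableAt_function τ x), h1]
    have hwpos : 0 < w (τ x) := Real.exp_pos _
    have : fieldDeriv Z G x * w (τ x) ≤ K * τ x ^ (-(1 + ε)) * G x * w (τ x) :=
      mul_le_mul_of_nonneg_right hZGle hwpos.le
    nlinarith
  obtain ⟨B, hB⟩ := bddAbove_of_fieldDeriv_nonpos hτ
    (fun x hx => (ha x ((le_max_left a 1).trans_lt hx)).1) hH hZH
  refine exists_bound_of_eventually (g i) (C := B + 1) ((hτ.eventually_iff hτc).2 ⟨b + 1,
    fun x hx => ?_⟩)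
  have h1 := hB x hx.le
  have hw1 : 1 ≤ w (τ x) := Real.one_le_exp (mul_nonneg (div_nonneg hKnn hε.le)
    (Real.rpow_nonneg (hpos x (by linarith)).le _))
  have h2 : G x ≤ B := (le_mul_of_one_le_right (hGnn x) hw1).trans h1
  have h3 : g i x * g i x ≤ G x :=
    Finset.single_le_sum (f := fun i => g i x * g i x) (fun _ _ => mul_self_nonneg _)
      (Finset.mem_univ i)
  rw [← abs_mul_abs_self] at h3
  nlinarith [abs_nonneg (g i x)]

end MaximumPrinciple

/-! ### Separating functions, cutoffs and a smooth exhaustion. -/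

section Cutoff

variable {n : ℕ} {M : Type*} [TopologicalSpace M] [ChartedSpace (EuclideanSpace ℝ (Fin n)) M]
  [IsManifold (𝓡 n) ∞ M] [T2Space M]

/-- Functions separating tangent vectors along a compact set. -/
theorem exists_finite_separating {N : Set M} (hN : IsCompact N) :
    ∃ S : Set C^∞⟮𝓡 n, M; ℝ⟯, S.Finite ∧ ∀ p ∈ N, ∀ w : TangentSpace (𝓡 n) p,
      (∀ v ∈ S, mvfderiv (𝓡 n) v p w = 0) → w = 0 := by
  refine hN.induction_on (p := fun N => ∃ S : Set C^∞⟮𝓡 n, M; ℝ⟯, S.Finite ∧ ∀ p ∈ N,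
    ∀ w : TangentSpace (𝓡 n) p, (∀ v ∈ S, mvfderiv (𝓡 n) v p w = 0) → w = 0)
    ⟨∅, Set.finite_empty, fun _ h => h.elim⟩ ?_ ?_ ?_
  · rintro s s' hs ⟨S, hS, h⟩
    exact ⟨S, hS, fun p hp => h p (hs hp)⟩
  · rintro s s' ⟨S, hS, h⟩ ⟨S', hS', h'⟩
    refine ⟨S ∪ S', hS.union hS', ?_⟩
    rintro p (hp | hp) w hw
    · exact h p hp w fun v hv => hw v (Or.inl hv)
    · exact h' p hp w fun v hv => hw v (Or.inr hv)
  · intro q _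
    -- Chart coordinates multiplied by a bump are globally smooth, and they separate tangent vectors
    -- wherever the bump is locally `1`.
    let f : SmoothBumpFunction (𝓡 n) q := Classical.arbitrary _
    let v : Fin n → C^∞⟮𝓡 n, M; ℝ⟯ := fun j =>
      ⟨fun x => f x • (extChartAt (𝓡 n) q x) j, f.contMDiff_smul (by
        have h1 : ContMDiffOn (𝓡 n) 𝓘(ℝ, EuclideanSpace ℝ (Fin n)) ∞ (extChartAt (𝓡 n) q)
          (chartAt (EuclideanSpace ℝ (Fin n)) q).source := contMDiffOn_extChartAt
        exact (EuclideanSpace.proj (𝕜 := ℝ) j).contMDiff.comp_contMDiffOn h1)⟩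
    refine ⟨(extChartAt (𝓡 n) q).source ∩ {x | ∀ᶠ y in 𝓝 x, f y = 1},
      mem_nhdsWithin_of_mem_nhds (inter_mem (extChartAt_source_mem_nhds q)
        (eventually_eventually_nhds.2 f.eventuallyEq_one)), Set.range v, Set.finite_range v, ?_⟩
    rintro p ⟨hps, hp1⟩ w hw
    have hchart : MDifferentiableAt (𝓡 n) 𝓘(ℝ, EuclideanSpace ℝ (Fin n))
        (extChartAt (𝓡 n) q) p :=
      mdifferentiableAt_extChartAt (by simpa using hps)
    have hinj := (isInvertible_mfderiv_extChartAt hps).injective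
    apply hinj
    rw [map_zero]
    refine PiLp.ext fun j => ?_
    have h1 := hw (v j) ⟨j, rfl⟩
    have h2 : (v j : M → ℝ) =ᶠ[𝓝 p] (EuclideanSpace.proj (𝕜 := ℝ) j) ∘ (extChartAt (𝓡 n) q) := by
      filter_upwards [hp1] with y hy
      change f y • (extChartAt (𝓡 n) q y) j = _
      rw [hy, one_smul]
      rfl
    have h3 := (EuclideanSpace.proj (𝕜 := ℝ) j).hasMFDerivAt.comp p hchart.hasMFDerivAt
    have h4 : mfderiv (𝓡 n) 𝓘(ℝ, ℝ) (v j) p w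
        = (EuclideanSpace.proj (𝕜 := ℝ) j)
          (mfderiv (𝓡 n) 𝓘(ℝ, EuclideanSpace ℝ (Fin n)) (extChartAt (𝓡 n) q) p w) := by
      rw [h2.mfderiv_eq, h3.mfderiv]
      rfl
    exact h4.symm.trans h1

variable [SecondCountableTopology M]

theorem exists_cutoff {K : Set M} (hK : IsCompact K) :
    ∃ χ : C^∞⟮𝓡 n, M; ℝ⟯, (∀ x ∈ K, ∀ᶠ y in 𝓝 x, χ y = 0) ∧
      ∀ᶠ x in cocompact M, χ x = 1 := by
  have : LocallyCompactSpace M := Manifold.locallyCompact_of_finiteDimensional (𝓡 n)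
  have : SigmaCompactSpace M := inferInstance
  obtain ⟨K', hK', hKK'⟩ := exists_compact_superset hK
  obtain ⟨f, hf1, hf0, -⟩ := exists_contMDiffMap_one_nhds_of_subset_interior (𝓡 n) (n := ⊤)
    hK.isClosed hKK'
  refine ⟨1 - f, fun x hx => ?_, ?_⟩
  · filter_upwards [(eventually_nhdsSet_iff_forall.1 hf1) x hx] with y hy
    simp [hy]
  · refine mem_cocompact.2 ⟨K', hK', fun x hx => ?_⟩
    simp [hf0 x hx]

/-- A function which is smooth near infinity agrees near infinity with a smooth function. -/
theorem exists_smooth_eq_near_infinity {F : M → ℝ}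
    (hF : ∀ᶠ x in cocompact M, ContMDiffAt (𝓡 n) 𝓘(ℝ, ℝ) ∞ F x) :
    ∃ f : C^∞⟮𝓡 n, M; ℝ⟯, ∀ᶠ x in cocompact M, f x = F x := by
  obtain ⟨K, hK, hKF⟩ := mem_cocompact.1 hF
  obtain ⟨χ, hχ0, hχ1⟩ := exists_cutoff (n := n) hK
  refine ⟨⟨fun x => χ x * F x, fun x => ?_⟩, ?_⟩
  · by_cases hx : x ∈ K
    · refine (contMDiffAt_const (c := (0 : ℝ))).congr_of_eventuallyEq ?_
      filter_upwards [hχ0 x hx] with y hy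
      simp [hy]
    · exact χ.contMDiff.contMDiffAt.mul (hKF hx)
  · filter_upwards [hχ1] with x hx
    change χ x * F x = F x
    rw [hx, one_mul]

/-- Everything later depends on `t` only near infinity, so a globally smooth `τ` may replace it;
properness with the lower bound makes the sublevel sets compact. -/
theorem exists_smooth_exhaustion {t : M → ℝ}
    (hsm : ∀ᶠ x in cocompact M, ContMDiffAt (𝓡 n) 𝓘(ℝ, ℝ) ∞ t x) (hprop : IsProperMap t)
    (hbdd : ∃ a : ℝ, ∀ x, a ≤ t x) :
    ∃ τ : C^∞⟮𝓡 n, M; ℝ⟯, IsExhausting τ ∧ ∀ᶠ x in cocompact M, τ x = t x := by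
  obtain ⟨τ, hτ⟩ := exists_smooth_eq_near_infinity hsm
  refine ⟨τ, fun S => ?_, hτ⟩
  obtain ⟨K, hK, hKτ⟩ := mem_cocompact.1 hτ
  obtain ⟨a, ha⟩ := hbdd
  refine (hK.union (hprop.isCompact_preimage (isCompact_Icc (a := a) (b := S)))).of_isClosed_subset
    (isClosed_le τ.contMDiff.continuous continuous_const) fun x hx => ?_
  by_cases hxK : x ∈ K
  · exact Or.inl hxK
  · have h : τ x = t x := hKτ hxK
    have hx' : τ x ≤ S := hx
    exact Or.inr ⟨ha x, h ▸ hx'⟩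

end Cutoff

/-! ### Invariant functions obtained from a level set. -/

section InvariantFunctions

variable {n : ℕ} {M : Type*} [TopologicalSpace M] [ChartedSpace (EuclideanSpace ℝ (Fin n)) M]

/-- Composition of a smooth function on `M` with a smooth function of a real variable. -/
def compReal (ψ : ℝ → ℝ) (hψ : ContDiff ℝ ∞ ψ) (τ : C^∞⟮𝓡 n, M; ℝ⟯) : C^∞⟮𝓡 n, M; ℝ⟯ :=
  ⟨fun x => ψ (τ x), hψ.contMDiff.comp τ.contMDiff⟩

variable [IsManifold (𝓡 n) ∞ M]

theorem fieldDeriv_smulField (f : C^∞⟮𝓡 n, M; ℝ⟯) (Z : SmoothVectorField n M) (g : M → ℝ) (x : M) :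
    fieldDeriv (smulField f Z) g x = f x * fieldDeriv Z g x :=
  map_smul (mvfderiv (𝓡 n) g x) (f x) (Z x)

/-- Along an integral curve of a field moving `τ` with speed in `[0, 1]`, the function `τ` is
monotone and `1`-Lipschitz. -/
theorem monotone_antitone_of_speed {τ : C^∞⟮𝓡 n, M; ℝ⟯} {Z : SmoothVectorField n M}
    (hZ : ∀ x, fieldDeriv Z τ x ∈ Set.Icc (0 : ℝ) 1) {γ : ℝ → M} (hγ : IsMIntegralCurve γ Z) :
    Monotone (fun s => τ (γ s)) ∧ Antitone (fun s => τ (γ s) - s) := by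
  have hd : ∀ s, HasDerivAt (fun s => τ (γ s)) (fieldDeriv Z τ (γ s)) s := fun s =>
    hasDerivAt_comp_integralCurve (hγ s) (mdifferentiableAt_function τ _)
  have hd' : ∀ s, HasDerivAt (fun s => τ (γ s) - s) (fieldDeriv Z τ (γ s) - 1) s := fun s =>
    (hd s).sub (hasDerivAt_id s)
  refine ⟨monotone_of_deriv_nonneg (fun s => (hd s).differentiableAt) fun s => ?_,
    antitone_of_deriv_nonpos (fun s => (hd' s).differentiableAt) fun s => ?_⟩
  · rw [(hd s).deriv]
    exact (hZ _).1
  · rw [(hd' s).deriv]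
    linarith [(hZ (γ s)).2]

variable [T2Space M]

/-- During time `A` a curve cannot rise above level `τ x + A`. Cutting the field off above that
level gives a compactly supported, hence complete, field whose curve from `x` is unaffected on `(-A,
A)`. -/
theorem exists_isMIntegralCurve_of_speed {τ : C^∞⟮𝓡 n, M; ℝ⟯} (hτ : IsExhausting τ)
    {Z : SmoothVectorField n M} (hZ : ∀ x, fieldDeriv Z τ x ∈ Set.Icc (0 : ℝ) 1) (x : M) :
    ∃ γ : ℝ → M, γ 0 = x ∧ IsMIntegralCurve γ Z := by
  refine (exists_isMIntegralCurve_iff_exists_isMIntegralCurveOn_Ioo (contMDiff_one Z) x).2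
    fun A => ?_
  set S := τ x + A with hS
  have hθ : ContDiff ℝ ∞ fun r : ℝ => Real.smoothTransition (S + 1 - r) :=
    Real.smoothTransition.contDiff.comp (contDiff_const.sub contDiff_id)
  let θ : C^∞⟮𝓡 n, M; ℝ⟯ := compReal _ hθ τ
  have hθ1 : ∀ y, τ y ≤ S → θ y = 1 := fun y hy =>
    Real.smoothTransition.one_of_one_le (by linarith)
  have hθ0 : ∀ y, ¬ τ y ≤ S + 1 → θ y = 0 := fun y hy =>
    Real.smoothTransition.zero_of_nonpos (by linarith [not_le.1 hy])
  have hZθ : ∀ y, fieldDeriv (smulField θ Z) τ y ∈ Set.Icc (0 : ℝ) 1 := by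
    intro y
    rw [fieldDeriv_smulField]
    have h0 : 0 ≤ θ y := Real.smoothTransition.nonneg _
    have h1 : θ y ≤ 1 := Real.smoothTransition.le_one _
    exact ⟨mul_nonneg h0 (hZ y).1, mul_le_one₀ h1 (hZ y).1 (hZ y).2⟩
  obtain ⟨γ, hγ0, hγ⟩ := exists_isMIntegralCurve_of_compact (smulField θ Z) (hτ (S + 1))
    (fun y hy => by rw [smulField_apply, hθ0 y hy, zero_smul]) x
  obtain ⟨hmono, hanti⟩ := monotone_antitone_of_speed hZθ hγ
  refine ⟨γ, hγ0, fun s hs => ?_⟩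
  have hle : τ (γ s) ≤ S := by
    rcases le_total s 0 with h | h
    · have := hmono h
      simp only [hγ0] at this
      have hA : 0 < A := by linarith [hs.1, hs.2]
      linarith
    · have := hanti h
      simp only [hγ0] at this
      linarith [hs.2]
  have := (hγ s).hasMFDerivWithinAt (s := Set.Ioo (-A) A)
  rwa [smulField_apply, hθ1 _ hle, one_smul] at this

/-- Finitely many smooth functions, invariant under `X` near infinity, which together with `τ`
separate tangent vectors near infinity. -/
theorem exists_invariant_functions {τ : C^∞⟮𝓡 n, M; ℝ⟯} (hτ : IsExhausting τ)
    {X : SmoothVectorField n M} {a : ℝ} (hX : ∀ x, a < τ x → fieldDeriv X τ x = 1) :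
    ∃ S : Set C^∞⟮𝓡 n, M; ℝ⟯, S.Finite ∧
      (∀ u ∈ S, ∀ x, a + 2 < τ x → fieldDeriv X u x = 0) ∧
      ∀ x, a + 2 < τ x → ∀ w : TangentSpace (𝓡 n) x, mvfderiv (𝓡 n) τ x w = 0 →
        (∀ u ∈ S, mvfderiv (𝓡 n) u x w = 0) → w = 0 := by
  have hψ : ContDiff ℝ ∞ fun r : ℝ => Real.smoothTransition (r - (a + 1)) :=
    Real.smoothTransition.contDiff.comp (contDiff_id.sub contDiff_const)
  let ψ : C^∞⟮𝓡 n, M; ℝ⟯ := compReal _ hψ τ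
  have hψ1 : ∀ y, a + 2 ≤ τ y → ψ y = 1 := fun y hy =>
    Real.smoothTransition.one_of_one_le (by linarith)
  have hψ0 : ∀ y, τ y ≤ a + 1 → ψ y = 0 := fun y hy =>
    Real.smoothTransition.zero_of_nonpos (by linarith)
  -- `X` is uncontrolled on the compact part; `Z` vanishes there, is complete, and equals `X` where
  -- `a + 2 ≤ τ`.
  set Z := smulField ψ X with hZdef
  have hZτ : ∀ y, fieldDeriv Z τ y = ψ y := by
    intro y
    rw [hZdef, fieldDeriv_smulField]
    rcases le_or_gt (τ y) a with h | h
    · rw [hψ0 y (by linarith), zero_mul]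
    · rw [hX y h, mul_one]
  have hspeed : ∀ y, fieldDeriv Z τ y ∈ Set.Icc (0 : ℝ) 1 := fun y => by
    rw [hZτ]
    exact ⟨Real.smoothTransition.nonneg _, Real.smoothTransition.le_one _⟩
  obtain ⟨φ, hφ, hφ0, hφc, hφg⟩ := exists_global_flow Z
    (exists_isMIntegralCurve_of_speed hτ hspeed)
  have hτφ : ∀ x, a + 2 < τ x → ∀ s, a + 2 - τ x ≤ s → τ (φ (s, x)) = τ x + s := by
    intro x hx s hs
    obtain ⟨hmono, hanti⟩ := monotone_antitone_of_speed hspeed (hφc x)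
    have hge : ∀ r, a + 2 - τ x ≤ r → a + 2 ≤ τ (φ (r, x)) := by
      intro r hr
      rcases le_total r 0 with h | h
      · have := hanti h
        simp only [hφ0] at this
        linarith
      · have := hmono h
        simp only [hφ0] at this
        linarith
    have hd : ∀ r ∈ Set.Ici (a + 2 - τ x),
        HasDerivWithinAt (fun r => τ (φ (r, x)) - r) 0 (Set.Ici (a + 2 - τ x)) r := by
      intro r hr
      have h1 := hasDerivAt_comp_integralCurve (hφc x r) (mdifferentiableAt_function τ _)
      rw [hZτ, hψ1 _ (hge r hr)] at h1
      exact ((h1.sub (hasDerivAt_id r)).congr_deriv (sub_self 1)).hasDerivWithinAt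
    have := (convex_Ici (a + 2 - τ x)).norm_image_sub_le_of_norm_hasDerivWithin_le
      (C := 0) hd (fun r _ => by simp) (show (0 : ℝ) ∈ Set.Ici (a + 2 - τ x) by
        simp only [Set.mem_Ici]; linarith) hs
    simp only [hφ0, zero_mul, norm_le_zero_iff] at this
    linarith
  set b := a + 3 with hb
  -- Sliding along the flow to level `b`, which lies strictly above `a + 2` and so in the region
  -- where `Z = X`. Functions composed with `π` are invariant there.
  let π : M → M := fun x => φ (b - τ x, x)
  have hβ : ContMDiff (𝓡 n) 𝓘(ℝ, ℝ) ∞ fun x => b - τ x := contMDiff_const.sub τ.contMDiff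
  have hπ : ContMDiff (𝓡 n) (𝓡 n) ∞ π := hφ.comp (hβ.prodMk contMDiff_id)
  have hτc : Continuous τ := τ.contMDiff.continuous
  have hN : IsCompact {x | τ x = b} :=
    (hτ b).of_isClosed_subset (isClosed_eq hτc continuous_const) fun x hx => le_of_eq hx
  obtain ⟨S₀, hS₀, hS₀N⟩ := exists_finite_separating (n := n) hN
  let P : C^∞⟮𝓡 n, M; ℝ⟯ → C^∞⟮𝓡 n, M; ℝ⟯ := fun v => ⟨v ∘ π, v.contMDiff.comp hπ⟩
  refine ⟨P '' S₀, hS₀.image P, ?_, ?_⟩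
  · rintro _ ⟨v, -, rfl⟩ x hx
    have hconst : ∀ᶠ s in 𝓝 (0 : ℝ), π (φ (s, x)) = π x := by
      filter_upwards [Ioi_mem_nhds (show a + 2 - τ x < 0 by linarith)] with s hs
      have h1 := hτφ x hx s (le_of_lt hs)
      change φ (b - τ (φ (s, x)), φ (s, x)) = φ (b - τ x, x)
      rw [← hφg, h1]
      congr 2
      ring
    have h1 := hasDerivAt_comp_integralCurve (hφc x 0) (mdifferentiableAt_function (P v) _)
    have h2 : HasDerivAt (fun s => P v (φ (s, x))) 0 0 := by
      refine (hasDerivAt_const (0 : ℝ) (v (π x))).congr_of_eventuallyEq ?_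
      filter_upwards [hconst] with s hs
      exact congrArg v hs
    have h3 := h1.unique h2
    simp only [hφ0] at h3
    rwa [hZdef, fieldDeriv_smulField, hψ1 x hx.le, one_mul] at h3
  · intro x hx w hwτ hw
    have hπx : MDifferentiableAt (𝓡 n) (𝓡 n) π x := hπ.mdifferentiable (by simp) x
    have hπN : τ (π x) = b := by
      change τ (φ (b - τ x, x)) = b
      rw [hτφ x hx _ (by rw [hb]; linarith)]
      ring
    have hdπ : mfderiv (𝓡 n) (𝓡 n) π x w = 0 := by
      refine hS₀N (π x) hπN _ fun v hv => ?_
      rw [← mvfderiv_comp_apply x (mdifferentiableAt_function v _) hπx]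
      exact hw _ ⟨v, hv, rfl⟩
    -- Flowing back recovers `y` from `τ y` and `π y`, so a vector killed by the differentials of
    -- both is zero.
    have hid : (fun y => φ (τ y - b, π y)) = id := by
      ext1 y
      change φ (τ y - b, φ (b - τ y, y)) = y
      rw [← hφg, sub_add_sub_cancel, sub_self, hφ0]
    have hβ' : HasMFDerivAt (𝓡 n) 𝓘(ℝ, ℝ) (fun y => τ y - b) x
        (mfderiv (𝓡 n) 𝓘(ℝ, ℝ) τ x) := by
      have h1 := (mdifferentiableAt_function τ x).hasMFDerivAt
      have h2 := h1.sub (hasMFDerivAt_const b x)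
      refine h2.congr_mfderiv ?_
      exact sub_zero _
    have hcomp := (hφ.mdifferentiable (by simp) (τ x - b, π x)).hasMFDerivAt.comp x
      (hβ'.prodMk hπx.hasMFDerivAt)
    have hcomp' : HasMFDerivAt (𝓡 n) (𝓡 n) (fun y => φ (τ y - b, π y)) x _ := hcomp
    rw [hid] at hcomp'
    have hzero := congrArg (fun L => L w) (hasMFDerivAt_unique hcomp' (hasMFDerivAt_id x))
    have hpair : ((mfderiv (𝓡 n) 𝓘(ℝ, ℝ) τ x).prod (mfderiv (𝓡 n) (𝓡 n) π x)) w = 0 := by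
      refine Prod.ext ?_ hdπ
      exact hwτ
    refine Eq.trans ?_ (hzero.symm.trans ?_)
    · rfl
    · exact (congrArg (fun q => mfderiv (𝓘(ℝ, ℝ).prod (𝓡 n)) (𝓡 n) φ (τ x - b, π x) q) hpair).trans
        (map_zero (mfderiv (𝓘(ℝ, ℝ).prod (𝓡 n)) (𝓡 n) φ (τ x - b, π x)))

end InvariantFunctions

/-! ### Linear algebra of the metric given by a separating family of functionals. -/

section GramLinear

open Matrix

variable {κ ι T : Type*} [Fintype κ] [DecidableEq κ] [Fintype ι] [AddCommGroup T] [Module ℝ T]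

/-- `Bᵀ * B` is the matrix of the form `∑ L_j²` in the basis `e`, positive definite since the `L j`
have no common kernel. -/
theorem det_gram_ne_zero (e : Module.Basis κ ℝ T) (L : ι → T →ₗ[ℝ] ℝ)
    (hL : ∀ w, (∀ j, L j w = 0) → w = 0) (B : Matrix ι κ ℝ) (hB : ∀ j a, B j a = L j (e a)) :
    (Bᵀ * B).det ≠ 0 := by
  have hinj : Function.Injective B.mulVec := by
    rw [← Matrix.coe_mulVecLin, injective_iff_map_eq_zero]
    intro c hc
    have hw : ∑ a, c a • e a = 0 := by
      refine hL _ fun j => ?_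
      have hcj := congrFun hc j
      simp only [Matrix.coe_mulVecLin, Matrix.mulVec, dotProduct, hB, Pi.zero_apply] at hcj
      simp only [map_sum, map_smul, smul_eq_mul]
      rw [← hcj]
      exact Finset.sum_congr rfl fun a _ => mul_comm _ _
    ext a
    exact Fintype.linearIndependent_iff.1 e.linearIndependent c hw a
  have h := Matrix.PosDef.conjTranspose_mul_self B hinj
  rw [Matrix.conjTranspose_eq_transpose_of_trivial] at h
  exact h.det_pos.ne'

/-- The vector on the right is the dual of `L i` for the inner product `∑ L_j ⊗ L_j`. -/
theorem gram_solution (e : Module.Basis κ ℝ T) (L : ι → T →ₗ[ℝ] ℝ)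
    (hL : ∀ w, (∀ j, L j w = 0) → w = 0) (B : Matrix ι κ ℝ) (hB : ∀ j a, B j a = L j (e a))
    (i : ι) (w : T) :
    L i w = ∑ j, L j w * L j (∑ a, ((Bᵀ * B)⁻¹ * Bᵀ) a i • e a) := by
  have hdet := det_gram_ne_zero e L hL B hB
  have hQ : (Bᵀ * B) * ((Bᵀ * B)⁻¹ * Bᵀ) = Bᵀ := by
    rw [← Matrix.mul_assoc, Matrix.mul_nonsing_inv _ (isUnit_iff_ne_zero.2 hdet), Matrix.one_mul]
  have key : L i = ∑ j, (L j (∑ a, ((Bᵀ * B)⁻¹ * Bᵀ) a i • e a)) • L j := by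
    refine e.ext fun b => ?_
    have h := congrFun (congrFun hQ b) i
    rw [Matrix.mul_assoc, Matrix.mul_apply] at h
    rw [← hB, ← Matrix.transpose_apply B, ← h, LinearMap.sum_apply]
    refine Finset.sum_congr rfl fun j _ => ?_
    rw [LinearMap.smul_apply, ← hB, Matrix.mul_apply, map_sum, Matrix.transpose_apply, smul_eq_mul,
      mul_comm]
    congr 1
    refine Finset.sum_congr rfl fun a _ => ?_
    rw [map_smul, ← hB, smul_eq_mul, mul_comm]
  have := congrArg (fun l : T →ₗ[ℝ] ℝ => l w) key
  simp only [LinearMap.sum_apply, LinearMap.smul_apply, smul_eq_mul] at this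
  rw [this]
  exact Finset.sum_congr rfl fun j _ => mul_comm _ _

theorem contDiff_det : ContDiff ℝ ∞ fun Q : κ → κ → ℝ => (Matrix.of Q).det := by
  simp only [Matrix.det_apply, Matrix.of_apply]
  refine ContDiff.sum fun σ _ => ContDiff.const_smul _ (contDiff_prod fun a _ => ?_)
  exact contDiff_apply_apply ℝ ℝ (σ a) a

theorem contDiffAt_inv_apply {Q : κ → κ → ℝ} (hQ : (Matrix.of Q).det ≠ 0) (a b : κ) :
    ContDiffAt ℝ ∞ (fun Q : κ → κ → ℝ => (Matrix.of Q)⁻¹ a b) Q := by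
  have h : (fun Q : κ → κ → ℝ => (Matrix.of Q)⁻¹ a b) = fun Q : κ → κ → ℝ =>
      (Matrix.of Q).det⁻¹ * (Matrix.of (Function.update Q b (Pi.single a 1))).det := by
    ext Q
    rw [Matrix.inv_def, Matrix.smul_apply, Ring.inverse_eq_inv', Matrix.adjugate_apply, smul_eq_mul]
    rfl
  rw [h]
  refine (contDiff_det.contDiffAt.inv hQ).mul (contDiff_det.comp ?_).contDiffAt
  refine contDiff_pi.2 fun c => ?_
  by_cases hc : c = b
  · subst hc
    simpa using contDiff_const
  · simpa [Function.update_of_ne hc] using contDiff_apply ℝ (κ → ℝ) c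

end GramLinear

/-! ### Smooth gradient fields. -/

section Frame

variable {n : ℕ} {M : Type*} [TopologicalSpace M] [ChartedSpace (EuclideanSpace ℝ (Fin n)) M]
  [IsManifold (𝓡 n) ∞ M]

theorem contMDiffAt_mvfderiv_section (u : C^∞⟮𝓡 n, M; ℝ⟯) {s : (x : M) → TangentSpace (𝓡 n) x}
    {x : M} (hs : ContMDiffAt (𝓡 n) (𝓡 n).tangent ∞ (fun y => (s y : TangentBundle (𝓡 n) M)) x) :
    ContMDiffAt (𝓡 n) 𝓘(ℝ, ℝ) ∞ (fun y => mvfderiv (𝓡 n) u y (s y)) x := by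
  have h1 := u.contMDiff.contMDiff_tangentMap (m := ∞) (by simp)
  exact (contMDiff_snd_tangentBundle_modelSpace ℝ 𝓘(ℝ, ℝ)).contMDiffAt.comp x
    (h1.contMDiffAt.comp x hs)

variable [T2Space M] [SecondCountableTopology M]

/-- The condition on `V x` is affine, so the local Gram solutions glue by a partition of unity.
Below level `b + 1` it is void and the zero section serves. -/
theorem exists_gram_field {ι : Type*} [Fintype ι] (u : ι → C^∞⟮𝓡 n, M; ℝ⟯) {τ : C^∞⟮𝓡 n, M; ℝ⟯}
    {b : ℝ} (hu : ∀ x, b < τ x → ∀ w : TangentSpace (𝓡 n) x,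
      (∀ j, mvfderiv (𝓡 n) (u j) x w = 0) → w = 0) (i : ι) :
    ∃ V : SmoothVectorField n M, ∀ x, b + 1 ≤ τ x → ∀ w : TangentSpace (𝓡 n) x,
      mvfderiv (𝓡 n) (u i) x w
        = ∑ j, mvfderiv (𝓡 n) (u j) x w * mvfderiv (𝓡 n) (u j) x (V x) := by
  have : LocallyCompactSpace M := Manifold.locallyCompact_of_finiteDimensional (𝓡 n)
  have : SigmaCompactSpace M := inferInstance
  have hτc : Continuous τ := τ.contMDiff.continuous
  let t : (x : M) → Set (TangentSpace (𝓡 n) x) := fun x =>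
    {v | b + 1 ≤ τ x → ∀ w : TangentSpace (𝓡 n) x, mvfderiv (𝓡 n) (u i) x w
        = ∑ j, mvfderiv (𝓡 n) (u j) x w * mvfderiv (𝓡 n) (u j) x v}
  have ht : ∀ x, Convex ℝ (t x) := by
    intro x v hv v' hv' p q _ _ hpq hx w
    have h1 := hv hx w
    have h2 := hv' hx w
    have h3 : ∀ j, mvfderiv (𝓡 n) (u j) x w * mvfderiv (𝓡 n) (u j) x (p • v + q • v')
        = p * (mvfderiv (𝓡 n) (u j) x w * mvfderiv (𝓡 n) (u j) x v)
          + q * (mvfderiv (𝓡 n) (u j) x w * mvfderiv (𝓡 n) (u j) x v') := by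
      intro j
      rw [map_add, map_smul, map_smul, smul_eq_mul, smul_eq_mul]
      ring
    simp only [h3, Finset.sum_add_distrib, ← Finset.mul_sum]
    rw [← h1, ← h2, ← add_mul, hpq, one_mul]
  obtain ⟨V, hV⟩ := exists_contMDiffSection_forall_mem_convex_of_local (𝓡 n) (n := ⊤)
    (TangentSpace (𝓡 n) : M → Type) t ht fun x₀ => by
      by_cases hx₀ : τ x₀ < b + 1
      · refine ⟨{x | τ x < b + 1}, (isOpen_lt hτc continuous_const).mem_nhds hx₀, fun _ => 0,
          (Bundle.contMDiff_zeroSection (F := EuclideanSpace ℝ (Fin n)) ℝ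
            (TangentSpace (𝓡 n) : M → Type)).contMDiffOn,
          fun y hy hy' => absurd hy' (not_le.2 hy)⟩
      · set e := trivializationAt (EuclideanSpace ℝ (Fin n)) (TangentSpace (𝓡 n) : M → Type) x₀
        let β := (EuclideanSpace.basisFun (Fin n) ℝ).toBasis
        let B : (x : M) → Matrix ι (Fin n) ℝ := fun x =>
          Matrix.of fun j a => mvfderiv (𝓡 n) (u j) x (e.localFrame β a x)
        have hmem : e.baseSet ∩ {x | b < τ x} ∈ 𝓝 x₀ :=
          inter_mem (e.open_baseSet.mem_nhds (FiberBundle.mem_baseSet_trivializationAt' x₀))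
            ((isOpen_lt continuous_const hτc).mem_nhds (by
              change b < τ x₀
              linarith [not_lt.1 hx₀]))
        refine ⟨_, hmem, fun x => ∑ a, (((B x).transpose * B x)⁻¹ * (B x).transpose) a i •
          e.localFrame β a x, ?_, ?_⟩
        · rintro x ⟨hxe, hxb⟩
          have hfr : ∀ a, ContMDiffAt (𝓡 n) (𝓡 n).tangent ∞
              (fun y => (e.localFrame β a y : TangentBundle (𝓡 n) M)) x := fun a =>
            contMDiffAt_localFrame_of_mem ∞ e β a hxe
          have hB : ∀ j a, ContMDiffAt (𝓡 n) 𝓘(ℝ, ℝ) ∞ (fun y => B y j a) x := fun j a =>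
            contMDiffAt_mvfderiv_section (u j) (hfr a)
          have hQ : ContMDiffAt (𝓡 n) 𝓘(ℝ, Fin n → Fin n → ℝ) ∞
              (fun y a c => ((B y).transpose * B y) a c) x := by
            refine contMDiffAt_pi_space.2 fun a => contMDiffAt_pi_space.2 fun c => ?_
            simp only [Matrix.mul_apply, Matrix.transpose_apply]
            exact ContMDiffAt.sum fun j _ => (hB j a).mul (hB j c)
          have hdet : ((B x).transpose * B x).det ≠ 0 :=
            det_gram_ne_zero (e.basisAt β hxe) (fun j => (mvfderiv (𝓡 n) (u j) x).toLinearMap)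
              (hu x hxb) (B x) fun j a => by simp [B, hxe]
          refine (ContMDiffAt.sum_section fun a _ => ContMDiffAt.smul_section ?_
            (hfr a)).contMDiffWithinAt
          simp only [Matrix.mul_apply (M := (_ : Matrix (Fin n) (Fin n) ℝ)⁻¹),
            Matrix.transpose_apply]
          refine ContMDiffAt.sum fun c _ => ContMDiffAt.mul ?_ (hB i c)
          exact (contDiffAt_inv_apply (Q := fun a c => ((B x).transpose * B x) a c) hdet a
            c).contMDiffAt.comp x hQ
        · rintro x ⟨hxe, hxb⟩ - w
          have := gram_solution (e.basisAt β hxe) (fun j => (mvfderiv (𝓡 n) (u j) x).toLinearMap)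
              (hu x hxb) (B x) (fun j a => by simp [B, hxe]) i w
          simpa [hxe] using this
  exact ⟨V, fun x hx w => hV x hx w⟩

end Frame

/-! ### Constant frames. -/

section ConstantFrame

universe u

variable {n : ℕ} {M : Type u} [TopologicalSpace M] [ChartedSpace (EuclideanSpace ℝ (Fin n)) M]
  [IsManifold (𝓡 n) ∞ M]

theorem mvfderiv_bracketField (Z W : SmoothVectorField n M) (f : C^∞⟮𝓡 n, M; ℝ⟯) (x : M) :
    mvfderiv (𝓡 n) f x (bracketField Z W x)
      = fieldDeriv Z (fieldDeriv W f) x - fieldDeriv W (fieldDeriv Z f) x :=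
  congrArg (fun g : C^∞⟮𝓡 n, M; ℝ⟯ => g x) (fieldOperator_bracketField Z W f)

theorem mdifferentiableAt_fieldDeriv (Z : SmoothVectorField n M) (f : C^∞⟮𝓡 n, M; ℝ⟯) (x : M) :
    MDifferentiableAt (𝓡 n) 𝓘(ℝ, ℝ) (fieldDeriv Z f) x :=
  mdifferentiableAt_function (fieldOperator Z f) x

/-- The fields dual to functions with constant derivative along `X`, for the metric induced by
these functions, commute with `X`. -/
theorem bracketField_gram_eq_zero {ι : Type*} [Fintype ι] (u : ι → C^∞⟮𝓡 n, M; ℝ⟯)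
    (V : ι → SmoothVectorField n M) (X : SmoothVectorField n M) (c : ι → ℝ) {O : Set M}
    (hO : IsOpen O)
    (hu : ∀ x ∈ O, ∀ w : TangentSpace (𝓡 n) x, (∀ j, mvfderiv (𝓡 n) (u j) x w = 0) → w = 0)
    (hc : ∀ j, ∀ x ∈ O, fieldDeriv X (u j) x = c j)
    (hV : ∀ i, ∀ x ∈ O, ∀ w : TangentSpace (𝓡 n) x, mvfderiv (𝓡 n) (u i) x w
        = ∑ j, mvfderiv (𝓡 n) (u j) x w * mvfderiv (𝓡 n) (u j) x (V i x)) :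
    ∀ x ∈ O, (∀ i, bracketField X (V i) x = 0) ∧
      ∀ v : TangentSpace (𝓡 n) x, v = ∑ i, mvfderiv (𝓡 n) (u i) x v • V i x := by
  intro x hx
  -- The matrix `Q` with entries `V_k(u_i)` satisfies `Q = Q Qᵀ`, so it is symmetric and idempotent.
  have hPP : ∀ x ∈ O, ∀ k i, fieldDeriv (V k) (u i) x
      = ∑ j, fieldDeriv (V k) (u j) x * fieldDeriv (V i) (u j) x := fun x hx k i =>
    hV i x hx (V k x)
  have hsymm : ∀ x ∈ O, ∀ k i, fieldDeriv (V k) (u i) x = fieldDeriv (V i) (u k) x := by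
    intro x hx k i
    rw [hPP x hx k i, hPP x hx i k]
    exact Finset.sum_congr rfl fun j _ => mul_comm _ _
  have hnear : ∀ᶠ y in 𝓝 x, y ∈ O := hO.mem_nhds hx
  constructor
  -- `D = X(Q)` is symmetric, and also records `[X, V_i](u_j)` because `X(u_j)` is constant. Duality
  -- gives `D = D Q`; differentiating `Q = Q Q` gives `D = D Q + Q D`. As `Q D = (D Q)ᵀ = D`, this
  -- forces `D = 0`.
  · set D : ι → ι → ℝ := fun i j => fieldDeriv X (fieldDeriv (V i) (u j)) x with hD
    have hbr : ∀ i j, mvfderiv (𝓡 n) (u j) x (bracketField X (V i) x) = D i j := by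
      intro i j
      rw [mvfderiv_bracketField, fieldDeriv_eq_zero_of_eventually_const (V i)
        (hnear.mono fun y hy => hc j y hy), sub_zero]
    have hDsymm : ∀ i j, D i j = D j i := fun i j =>
      fieldDeriv_congr X (hnear.mono fun y hy => hsymm y hy i j)
    have hD1 : ∀ i k, D i k = ∑ j, D i j * fieldDeriv (V k) (u j) x := by
      intro i k
      have h := hV k x hx (bracketField X (V i) x)
      simp only [hbr] at h
      exact h
    have hD2 : ∀ i k, D i k = ∑ j, (D i j * fieldDeriv (V k) (u j) x
        + fieldDeriv (V i) (u j) x * D k j) := by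
      intro i k
      have h := fieldDeriv_congr X (hnear.mono fun y hy => hPP y hy i k)
      refine h.trans ((fieldDeriv_fun_sum X Finset.univ fun j _ =>
        (mdifferentiableAt_fieldDeriv _ _ x).mul (mdifferentiableAt_fieldDeriv _ _ x)).trans ?_)
      refine Finset.sum_congr rfl fun j _ => ?_
      exact fieldDeriv_fun_mul X (mdifferentiableAt_fieldDeriv _ _ x)
        (mdifferentiableAt_fieldDeriv _ _ x)
    intro i
    refine hu x hx _ fun k => ?_
    rw [hbr]
    have h2 := hD2 i k
    rw [Finset.sum_add_distrib, ← hD1 i k] at h2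
    have h3 := hD1 k i
    have h4 : ∑ j, fieldDeriv (V i) (u j) x * D k j = D k i := by
      rw [h3]
      exact Finset.sum_congr rfl fun j _ => mul_comm _ _
    rw [h4] at h2
    rw [hDsymm]
    linarith
  · intro v
    rw [← sub_eq_zero]
    refine hu x hx _ fun k => ?_
    rw [map_sub, map_sum, sub_eq_zero]
    simp only [map_smul, smul_eq_mul]
    rw [hV k x hx v]
    exact Finset.sum_congr rfl fun j _ => congrArg _ (hsymm x hx k j)

/-- Functions and constant fields which together express every vector field near infinity through
its values on the functions. The functions are invariant near infinity or equal to `τ`. -/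
structure IsConstantFrame (X : SmoothVectorField n M) (τ : C^∞⟮𝓡 n, M; ℝ⟯) {ι : Type*} [Fintype ι]
    (u : ι → C^∞⟮𝓡 n, M; ℝ⟯) (V : ι → SmoothVectorField n M) : Prop where
  isConstantField : ∀ i, IsConstantField X (V i)
  invariant_or_eq : ∀ i, (∀ᶠ x in cocompact M, fieldDeriv X (u i) x = 0) ∨ u i = τ
  eq_sum : ∀ᶠ x in cocompact M, ∀ v : TangentSpace (𝓡 n) x,
    v = ∑ i, mvfderiv (𝓡 n) (u i) x v • V i x

variable [T2Space M] [SecondCountableTopology M]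

theorem exists_constant_frame {τ : C^∞⟮𝓡 n, M; ℝ⟯} (hτ : IsExhausting τ)
    {X : SmoothVectorField n M} (hX : ∀ᶠ x in cocompact M, fieldDeriv X τ x = 1) :
    ∃ (ι : Type u) (_ : Fintype ι) (u : ι → C^∞⟮𝓡 n, M; ℝ⟯) (V : ι → SmoothVectorField n M),
      IsConstantFrame X τ u V := by
  have hτc : Continuous τ := τ.contMDiff.continuous
  obtain ⟨a, ha⟩ := (hτ.eventually_iff hτc).1 hX
  obtain ⟨S, hS, hS0, hSinj⟩ := exists_invariant_functions hτ ha
  have : Fintype S := hS.fintype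
  let u : Option S → C^∞⟮𝓡 n, M; ℝ⟯ := fun o => o.elim τ (fun s => s.1)
  let c : Option S → ℝ := fun o => o.elim 1 (fun _ => 0)
  have hu : ∀ x, a + 2 < τ x → ∀ w : TangentSpace (𝓡 n) x,
      (∀ j, mvfderiv (𝓡 n) (u j) x w = 0) → w = 0 := fun x hx w hw =>
    hSinj x hx w (hw none) fun v hv => hw (some ⟨v, hv⟩)
  have hc : ∀ j x, a + 2 < τ x → fieldDeriv X (u j) x = c j := by
    rintro (_ | s) x hx
    · exact ha x (by linarith)
    · exact hS0 s.1 s.2 x hx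
  choose V hV using exists_gram_field u hu
  have key := bracketField_gram_eq_zero u V X c (O := {x | a + 3 < τ x})
    (isOpen_lt continuous_const hτc)
    (fun x (hx : a + 3 < τ x) => hu x (by linarith))
    (fun j x (hx : a + 3 < τ x) => hc j x (by linarith))
    (fun i x (hx : a + 3 < τ x) => hV i x (by linarith))
  have hev : ∀ᶠ x in cocompact M, a + 3 < τ x := (hτ.eventually_iff hτc).2 ⟨a + 3, fun _ h => h⟩
  refine ⟨Option S, inferInstance, u, V, fun i => ?_, ?_, ?_⟩
  · filter_upwards [hev] with x hx
    have h := (key x hx).1 i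
    rw [bracketField_swap] at h
    exact neg_eq_zero.1 h
  · rintro (_ | s)
    · exact Or.inr rfl
    · left
      filter_upwards [hev] with x hx
      exact hc (some s) x (by linarith)
  · filter_upwards [hev] with x hx
    exact (key x hx).2

end ConstantFrame

/-! ### The space of functions bounded with all derivatives. -/

section BoundedWithDerivatives

universe u

variable {n : ℕ} {M : Type u} [TopologicalSpace M] [ChartedSpace (EuclideanSpace ℝ (Fin n)) M]

theorem sum_function_apply {ι : Type*} (s : Finset ι) (f : ι → C^∞⟮𝓡 n, M; ℝ⟯) (x : M) :
    (∑ i ∈ s, f i) x = ∑ i ∈ s, f i x := by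
  have h := map_sum (ContMDiffMap.coeFnAlgHom : C^∞⟮𝓡 n, M; ℝ⟯ →ₐ[ℝ] M → ℝ) f s
  have hx := congrFun h x
  rwa [Finset.sum_apply] at hx

/-- The functions equal near infinity to a linear combination of elements of `G`. -/
def nearSpan (G : Set C^∞⟮𝓡 n, M; ℝ⟯) : Submodule ℝ C^∞⟮𝓡 n, M; ℝ⟯ :=
  Submodule.span ℝ (G ∪ {f | f =ᶠ[cocompact M] (0 : C^∞⟮𝓡 n, M; ℝ⟯)})

theorem subset_nearSpan {G : Set C^∞⟮𝓡 n, M; ℝ⟯} {f : C^∞⟮𝓡 n, M; ℝ⟯} (hf : f ∈ G) :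
    f ∈ nearSpan G :=
  Submodule.subset_span (Or.inl hf)

theorem mem_nearSpan_of_eventuallyEq {G : Set C^∞⟮𝓡 n, M; ℝ⟯} {f g : C^∞⟮𝓡 n, M; ℝ⟯}
    (hg : g ∈ nearSpan G) (h : f =ᶠ[cocompact M] g) : f ∈ nearSpan G := by
  rw [← sub_add_cancel f g]
  refine add_mem (Submodule.subset_span (Or.inr ?_)) hg
  filter_upwards [h] with x hx
  simp [hx]

variable [IsManifold (𝓡 n) ∞ M]

theorem fieldOperator_apply (Z : SmoothVectorField n M) (f : C^∞⟮𝓡 n, M; ℝ⟯) (x : M) :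
    fieldOperator Z f x = fieldDeriv Z f x := rfl

theorem fieldOperator_mul (Z : SmoothVectorField n M) (f g : C^∞⟮𝓡 n, M; ℝ⟯) :
    fieldOperator Z (f * g) = fieldOperator Z f * g + f * fieldOperator Z g := by
  ext x
  exact fieldDeriv_fun_mul Z (mdifferentiableAt_function f x) (mdifferentiableAt_function g x)

theorem IsConstantField.fieldOperator_comm {X Z : SmoothVectorField n M}
    (hZ : IsConstantField X Z) (f : C^∞⟮𝓡 n, M; ℝ⟯) :
    fieldOperator X (fieldOperator Z f) =ᶠ[cocompact M] fieldOperator Z (fieldOperator X f) := by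
  filter_upwards [hZ] with x hx
  have h := mvfderiv_bracketField Z X f x
  rw [bracketField_apply, hx, map_zero] at h
  exact (sub_eq_zero.1 h.symm).symm

theorem IsConstantFrame.fieldDeriv_eq_sum {X : SmoothVectorField n M} {τ : C^∞⟮𝓡 n, M; ℝ⟯}
    {ι : Type*} [Fintype ι] {u : ι → C^∞⟮𝓡 n, M; ℝ⟯} {V : ι → SmoothVectorField n M}
    (h : IsConstantFrame X τ u V) (Z : SmoothVectorField n M) (f : C^∞⟮𝓡 n, M; ℝ⟯) :
    fieldOperator Z f =ᶠ[cocompact M]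
      (∑ i, fieldOperator Z (u i) * fieldOperator (V i) f : C^∞⟮𝓡 n, M; ℝ⟯) := by
  filter_upwards [h.eq_sum] with x hx
  have h1 := congrArg (mvfderiv (𝓡 n) f x) (hx (Z x))
  rw [map_sum] at h1
  simp only [map_smul, smul_eq_mul] at h1
  refine h1.trans ?_
  rw [sum_function_apply]
  rfl

/-- The functions bounded with all their derivatives, as a submodule. -/
def boundedSubmodule (X : SmoothVectorField n M) : Submodule ℝ C^∞⟮𝓡 n, M; ℝ⟯ where
  carrier := {f | IsBoundedWithDerivatives X f}
  add_mem' {f g} hf hg D hD := by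
    obtain ⟨C, hC⟩ := hf D hD
    obtain ⟨C', hC'⟩ := hg D hD
    refine ⟨C + C', fun x => ?_⟩
    rw [map_add]
    exact (abs_add_le _ _).trans (add_le_add (hC x) (hC' x))
  zero_mem' D _ := ⟨0, fun x => by simp⟩
  smul_mem' c f hf D hD := by
    obtain ⟨C, hC⟩ := hf D hD
    refine ⟨|c| * C, fun x => ?_⟩
    rw [map_smul]
    exact (abs_mul c _).trans_le (mul_le_mul_of_nonneg_left (hC x) (abs_nonneg c))

theorem exists_bound_of_mem_boundedSubmodule {X : SmoothVectorField n M} {f : C^∞⟮𝓡 n, M; ℝ⟯}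
    (hf : f ∈ boundedSubmodule X) : ∃ C, ∀ x, |f x| ≤ C :=
  hf 1 (one_mem _)

theorem fieldOperator_mem_boundedSubmodule {X Z : SmoothVectorField n M}
    (hZ : IsConstantField X Z) {f : C^∞⟮𝓡 n, M; ℝ⟯} (hf : f ∈ boundedSubmodule X) :
    fieldOperator Z f ∈ boundedSubmodule X := fun D hD =>
  hf (D * fieldOperator Z) (mul_mem hD (Algebra.subset_adjoin ⟨Z, hZ, rfl⟩))

/-- A space stable under the generators is stable under the algebra they generate. This maximality
replaces all estimates of iterated derivatives. -/
theorem le_boundedSubmodule {X : SmoothVectorField n M} {B : Submodule ℝ C^∞⟮𝓡 n, M; ℝ⟯}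
    (hB : ∀ f ∈ B, ∃ C, ∀ x, |f x| ≤ C)
    (hst : ∀ Z, IsConstantField X Z → ∀ f ∈ B, fieldOperator Z f ∈ B) :
    B ≤ boundedSubmodule X := by
  intro f hf D hD
  refine hB _ ?_
  revert f
  change ∀ f ∈ B, D f ∈ B
  induction hD using Algebra.adjoin_induction with
  | mem D hD =>
    obtain ⟨Z, hZ, rfl⟩ := hD
    exact hst Z hZ
  | algebraMap r => exact fun f hf => B.smul_mem r hf
  | add D D' _ _ h h' => exact fun f hf => B.add_mem (h f hf) (h' f hf)
  | mul D D' _ _ h h' => exact fun f hf => h _ (h' f hf)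

/-- A function which is invariant near infinity. -/
def IsInvariant (X : SmoothVectorField n M) (f : C^∞⟮𝓡 n, M; ℝ⟯) : Prop :=
  fieldOperator X f =ᶠ[cocompact M] (0 : C^∞⟮𝓡 n, M; ℝ⟯)

theorem IsInvariant.mul {X : SmoothVectorField n M} {f g : C^∞⟮𝓡 n, M; ℝ⟯} (hf : IsInvariant X f)
    (hg : IsInvariant X g) : IsInvariant X (f * g) := by
  rw [IsInvariant, fieldOperator_mul]
  filter_upwards [hf, hg] with x hx hx'
  simp [hx, hx']

theorem isInvariant_one (X : SmoothVectorField n M) : IsInvariant X 1 :=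
  Eventually.of_forall fun x => fieldDeriv_const X 1 x

theorem IsInvariant.exists_bound {X : SmoothVectorField n M} {τ : C^∞⟮𝓡 n, M; ℝ⟯}
    (hτ : IsExhausting τ) (hX : ∀ᶠ x in cocompact M, fieldDeriv X τ x = 1)
    {f : C^∞⟮𝓡 n, M; ℝ⟯} (hf : IsInvariant X f) : ∃ C, ∀ x, |f x| ≤ C := by
  -- A one-function system with zero coefficient; the exponent `1` is arbitrary.
  refine bounded_of_linear_system hτ hX one_pos (ι := Unit) (fun _ => f) (fun _ _ _ => 0)
    (fun _ _ => ⟨0, by simp⟩) (fun _ => ?_) ()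
  filter_upwards [hf] with x hx
  simpa [fieldOperator_apply] using hx

variable [T2Space M]

theorem eventually_nhds_of_eventually_cocompact {P : M → Prop} (h : ∀ᶠ x in cocompact M, P x) :
    ∀ᶠ x in cocompact M, ∀ᶠ y in 𝓝 x, P y := by
  obtain ⟨K, hK, hKP⟩ := mem_cocompact.1 h
  refine mem_cocompact.2 ⟨K, hK, fun x hx => ?_⟩
  exact mem_of_superset (hK.isClosed.isOpen_compl.mem_nhds hx) hKP

theorem fieldOperator_eventuallyEq (Z : SmoothVectorField n M) {f g : C^∞⟮𝓡 n, M; ℝ⟯}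
    (h : f =ᶠ[cocompact M] g) : fieldOperator Z f =ᶠ[cocompact M] fieldOperator Z g := by
  filter_upwards [eventually_nhds_of_eventually_cocompact h] with x hx
  exact fieldDeriv_congr Z hx

/-- The working form of maximality: only generators need checking, and errors on compact sets are
harmless because a smooth function is bounded there and derivations preserve vanishing near
infinity. -/
theorem nearSpan_le_boundedSubmodule {X : SmoothVectorField n M} {G : Set C^∞⟮𝓡 n, M; ℝ⟯}
    (hG : ∀ f ∈ G, ∃ C, ∀ᶠ x in cocompact M, |f x| ≤ C)
    (hst : ∀ Z, IsConstantField X Z → ∀ f ∈ G, fieldOperator Z f ∈ nearSpan G) :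
    nearSpan G ≤ boundedSubmodule X := by
  refine le_boundedSubmodule (fun f hf => ?_) fun Z hZ f hf => ?_
  · refine Submodule.span_induction (p := fun f _ => ∃ C, ∀ x, |f x| ≤ C) ?_ ⟨0, by simp⟩ ?_ ?_ hf
    · rintro f (hf | hf)
      · obtain ⟨C, hC⟩ := hG f hf
        exact exists_bound_of_eventually f hC
      · refine exists_bound_of_eventually f (C := 0) ?_
        filter_upwards [hf] with x hx
        simp [hx]
    · rintro f g - - ⟨C, hC⟩ ⟨C', hC'⟩
      exact ⟨C + C', fun x => (abs_add_le _ _).trans (add_le_add (hC x) (hC' x))⟩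
    · rintro c f - ⟨C, hC⟩
      exact ⟨|c| * C, fun x => (abs_mul c _).trans_le
        (mul_le_mul_of_nonneg_left (hC x) (abs_nonneg c))⟩
  · refine Submodule.span_induction (p := fun f _ => fieldOperator Z f ∈ nearSpan G) ?_ ?_ ?_ ?_ hf
    · rintro f (hf | hf)
      · exact hst Z hZ f hf
      · have h := fieldOperator_eventuallyEq Z (f := f) (g := 0) hf
        rw [map_zero] at h
        exact Submodule.subset_span (Or.inr h)
    · rw [map_zero]
      exact zero_mem _
    · intro f g _ _ hf hg
      rw [map_add]
      exact add_mem hf hg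
    · intro c f _ hf
      rw [map_smul]
      exact Submodule.smul_mem _ c hf

theorem mem_boundedSubmodule_of_eventuallyEq {X : SmoothVectorField n M} {f g : C^∞⟮𝓡 n, M; ℝ⟯}
    (hg : g ∈ boundedSubmodule X) (h : f =ᶠ[cocompact M] g) : f ∈ boundedSubmodule X := by
  refine nearSpan_le_boundedSubmodule (G := boundedSubmodule X) ?_ ?_
    (mem_nearSpan_of_eventuallyEq (subset_nearSpan hg) h)
  · intro f hf
    obtain ⟨C, hC⟩ := exists_bound_of_mem_boundedSubmodule hf
    exact ⟨C, Eventually.of_forall hC⟩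
  · exact fun Z hZ f hf => subset_nearSpan (fieldOperator_mem_boundedSubmodule hZ hf)

theorem mul_mem_boundedSubmodule {X : SmoothVectorField n M} {f g : C^∞⟮𝓡 n, M; ℝ⟯}
    (hf : f ∈ boundedSubmodule X) (hg : g ∈ boundedSubmodule X) :
    f * g ∈ boundedSubmodule X := by
  refine nearSpan_le_boundedSubmodule
    (G := {h | ∃ f ∈ boundedSubmodule X, ∃ g ∈ boundedSubmodule X, h = f * g}) ?_ ?_
    (subset_nearSpan ⟨f, hf, g, hg, rfl⟩)
  · rintro _ ⟨f, hf, g, hg, rfl⟩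
    obtain ⟨C, hC⟩ := exists_bound_of_mem_boundedSubmodule hf
    obtain ⟨C', hC'⟩ := exists_bound_of_mem_boundedSubmodule hg
    refine ⟨C * C', Eventually.of_forall fun x => ?_⟩
    exact (abs_mul _ _).trans_le (mul_le_mul (hC x) (hC' x) (abs_nonneg _)
      ((abs_nonneg _).trans (hC x)))
  · rintro Z hZ _ ⟨f, hf, g, hg, rfl⟩
    rw [fieldOperator_mul]
    exact add_mem
      (subset_nearSpan ⟨_, fieldOperator_mem_boundedSubmodule hZ hf, _, hg, rfl⟩)
      (subset_nearSpan ⟨_, hf, _, fieldOperator_mem_boundedSubmodule hZ hg, rfl⟩)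

theorem IsInvariant.fieldOperator_of_isConstantField {X Z : SmoothVectorField n M}
    (hZ : IsConstantField X Z) {f : C^∞⟮𝓡 n, M; ℝ⟯} (hf : IsInvariant X f) : IsInvariant X (fieldOperator Z f) := by
  have h := fieldOperator_eventuallyEq Z hf
  rw [map_zero] at h
  exact (hZ.fieldOperator_comm f).trans h

theorem isInvariant_fieldOperator_of_deriv_eq_one {X Z : SmoothVectorField n M}
    (hZ : IsConstantField X Z) {τ : C^∞⟮𝓡 n, M; ℝ⟯}
    (hX : ∀ᶠ x in cocompact M, fieldDeriv X τ x = 1) : IsInvariant X (fieldOperator Z τ) := by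
  have h1 : fieldOperator X τ =ᶠ[cocompact M] (1 : C^∞⟮𝓡 n, M; ℝ⟯) := hX
  have h2 : fieldOperator Z (1 : C^∞⟮𝓡 n, M; ℝ⟯) = 0 := by
    ext x
    exact fieldDeriv_const Z 1 x
  have h := fieldOperator_eventuallyEq Z h1
  rw [h2] at h
  exact (hZ.fieldOperator_comm τ).trans h

theorem IsConstantFrame.isInvariant_fieldOperator {X : SmoothVectorField n M}
    {τ : C^∞⟮𝓡 n, M; ℝ⟯} (hX : ∀ᶠ x in cocompact M, fieldDeriv X τ x = 1)
    {ι : Type*} [Fintype ι] {u : ι → C^∞⟮𝓡 n, M; ℝ⟯} {V : ι → SmoothVectorField n M}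
    (h : IsConstantFrame X τ u V) {Z : SmoothVectorField n M} (hZ : IsConstantField X Z) (i : ι) :
    IsInvariant X (fieldOperator Z (u i)) := by
  rcases h.invariant_or_eq i with hi | hi
  · exact IsInvariant.fieldOperator_of_isConstantField hZ hi
  · rw [hi]
    exact isInvariant_fieldOperator_of_deriv_eq_one hZ hX

theorem IsInvariant.mem_boundedSubmodule {X : SmoothVectorField n M} {τ : C^∞⟮𝓡 n, M; ℝ⟯}
    (hτ : IsExhausting τ) (hX : ∀ᶠ x in cocompact M, fieldDeriv X τ x = 1)
    {f : C^∞⟮𝓡 n, M; ℝ⟯} (hf : IsInvariant X f) : f ∈ boundedSubmodule X := by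
  refine nearSpan_le_boundedSubmodule (G := {f | IsInvariant X f}) (fun g hg => ?_)
    (fun Z hZ g hg => subset_nearSpan (IsInvariant.fieldOperator_of_isConstantField hZ hg))
    (subset_nearSpan hf)
  obtain ⟨C, hC⟩ := IsInvariant.exists_bound hτ hX hg
  exact ⟨C, Eventually.of_forall hC⟩

end BoundedWithDerivatives

/-! ### Functions decaying at the rate `ρ`. -/

section DecayingFunctions

variable {n : ℕ} {M : Type*} [TopologicalSpace M] [ChartedSpace (EuclideanSpace ℝ (Fin n)) M]

theorem IsExhausting.eventually_lt {τ : C^∞⟮𝓡 n, M; ℝ⟯} (hτ : IsExhausting τ) (a : ℝ) :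
    ∀ᶠ x in cocompact M, a < τ x :=
  (hτ.eventually_iff τ.contMDiff.continuous).2 ⟨a, fun _ h => h⟩

variable [IsManifold (𝓡 n) ∞ M]

theorem fieldOperator_add (Z W : SmoothVectorField n M) (f : C^∞⟮𝓡 n, M; ℝ⟯) :
    fieldOperator (Z + W) f = fieldOperator Z f + fieldOperator W f := by
  ext x
  exact fieldDeriv_add_field Z W f x

/-- The functions equal near infinity to the product of `ρ` with a function bounded with all its
derivatives. -/
def decayingSubmodule (X : SmoothVectorField n M) (ρ : C^∞⟮𝓡 n, M; ℝ⟯) :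
    Submodule ℝ C^∞⟮𝓡 n, M; ℝ⟯ where
  carrier := {h | ∃ b ∈ boundedSubmodule X, h =ᶠ[cocompact M] (ρ * b : C^∞⟮𝓡 n, M; ℝ⟯)}
  add_mem' := by
    rintro f g ⟨b, hb, hf⟩ ⟨b', hb', hg⟩
    refine ⟨b + b', add_mem hb hb', ?_⟩
    filter_upwards [hf, hg] with x hx hx'
    rw [mul_add]
    exact congrArg₂ (· + ·) hx hx'
  zero_mem' := ⟨0, zero_mem _, by rw [mul_zero]⟩
  smul_mem' := by
    rintro c f ⟨b, hb, hf⟩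
    refine ⟨c • b, Submodule.smul_mem _ c hb, ?_⟩
    filter_upwards [hf] with x hx
    rw [mul_smul_comm]
    exact congrArg (c * ·) hx

theorem mem_decayingSubmodule_of_eventuallyEq {X : SmoothVectorField n M}
    {ρ f g : C^∞⟮𝓡 n, M; ℝ⟯} (hg : g ∈ decayingSubmodule X ρ) (h : f =ᶠ[cocompact M] g) :
    f ∈ decayingSubmodule X ρ := by
  obtain ⟨b, hb, hgb⟩ := hg
  exact ⟨b, hb, h.trans hgb⟩

theorem mem_decayingSubmodule_of_eventuallyEq_zero {X : SmoothVectorField n M}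
    {ρ f : C^∞⟮𝓡 n, M; ℝ⟯} (h : f =ᶠ[cocompact M] (0 : C^∞⟮𝓡 n, M; ℝ⟯)) :
    f ∈ decayingSubmodule X ρ :=
  mem_decayingSubmodule_of_eventuallyEq (zero_mem _) h

variable [T2Space M]

/-- Near infinity `Z(σ ^ k) = -k σ ^ (k + 1) Z(τ)` with `Z(τ)` invariant, so products of powers of
`σ` with invariant functions are closed under constant fields. -/
theorem mem_boundedSubmodule_of_eventuallyEq_inv {X : SmoothVectorField n M}
    {τ σ : C^∞⟮𝓡 n, M; ℝ⟯} (hτ : IsExhausting τ)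
    (hX : ∀ᶠ x in cocompact M, fieldDeriv X τ x = 1)
    (hσ : ∀ᶠ x in cocompact M, σ x = (τ x)⁻¹) : σ ∈ boundedSubmodule X := by
  refine nearSpan_le_boundedSubmodule (G := {f | ∃ (k : ℕ) (a : C^∞⟮𝓡 n, M; ℝ⟯),
    IsInvariant X a ∧ f = σ ^ k * a}) ?_ ?_ (subset_nearSpan ⟨1, 1, isInvariant_one X, by simp⟩)
  · rintro _ ⟨k, a, ha, rfl⟩
    obtain ⟨C, hC⟩ := ha.exists_bound hτ hX
    refine ⟨C, ?_⟩
    filter_upwards [hσ, hτ.eventually_lt 1] with x hx hx1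
    have h1 : |σ x| ≤ 1 := by
      rw [hx, abs_of_nonneg (inv_nonneg.2 (by linarith))]
      exact inv_le_one_of_one_le₀ hx1.le
    change |σ x ^ k * a x| ≤ C
    rw [abs_mul, abs_pow]
    calc |σ x| ^ k * |a x| ≤ 1 * |a x| :=
          mul_le_mul_of_nonneg_right (pow_le_one₀ (abs_nonneg _) h1) (abs_nonneg _)
      _ ≤ C := by rw [one_mul]; exact hC x
  · rintro Z hZ _ ⟨k, a, ha, rfl⟩
    rw [fieldOperator_mul]
    refine add_mem ?_ (subset_nearSpan ⟨k, _, ha.fieldOperator_of_isConstantField hZ, rfl⟩)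
    refine mem_nearSpan_of_eventuallyEq
      (g := (-(k : ℝ)) • (σ ^ (k + 1) * (fieldOperator Z τ * a))) ?_ ?_
    · exact Submodule.smul_mem _ _ (subset_nearSpan
        ⟨k + 1, _, (isInvariant_fieldOperator_of_deriv_eq_one hZ hX).mul ha, rfl⟩)
    · filter_upwards [eventually_nhds_of_eventually_cocompact hσ, hτ.eventually_lt 1] with x hx hx1
      have hne : τ x ≠ 0 := by linarith
      have h1 : fieldDeriv Z σ x = -(τ x ^ 2)⁻¹ * fieldDeriv Z τ x :=
        (fieldDeriv_congr Z hx).trans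
          (fieldDeriv_comp Z (hasDerivAt_inv hne) (mdifferentiableAt_function τ x))
      have h2 : fieldDeriv Z (fun y => σ y ^ k) x = (k * σ x ^ (k - 1)) * fieldDeriv Z σ x :=
        fieldDeriv_comp Z (hasDerivAt_pow k (σ x)) (mdifferentiableAt_function σ x)
      change fieldDeriv Z (fun y => σ y ^ k) x * a x
        = -(k : ℝ) * (σ x ^ (k + 1) * (fieldDeriv Z τ x * a x))
      rw [h2, h1, ← inv_pow, ← hx.self_of_nhds]
      cases k with
      | zero => simp
      | succ k =>
        rw [Nat.add_sub_cancel]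
        ring

end DecayingFunctions

/-! ### Decaying perturbations and their brackets with constant fields. -/

section DecayingPerturbation

variable {n : ℕ} {M : Type*} [TopologicalSpace M] [ChartedSpace (EuclideanSpace ℝ (Fin n)) M]

theorem exists_coefficients_of_mem_nearSpan {I : Submodule ℝ C^∞⟮𝓡 n, M; ℝ⟯}
    {H : Set C^∞⟮𝓡 n, M; ℝ⟯} [Fintype H] {f : C^∞⟮𝓡 n, M; ℝ⟯}
    (hf : f ∈ nearSpan {f | ∃ a ∈ I, ∃ h ∈ H, f = a * h}) :
    ∃ A : H → C^∞⟮𝓡 n, M; ℝ⟯, (∀ h, A h ∈ I) ∧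
      ∀ᶠ x in cocompact M, f x = ∑ h : H, A h x * h.1 x := by
  classical
  refine Submodule.span_induction (p := fun f _ => ∃ A : H → C^∞⟮𝓡 n, M; ℝ⟯, (∀ h, A h ∈ I) ∧
      ∀ᶠ x in cocompact M, f x = ∑ h : H, A h x * h.1 x) ?_ ?_ ?_ ?_ hf
  · rintro f (⟨a, ha, h, hh, rfl⟩ | hf)
    · refine ⟨Pi.single ⟨h, hh⟩ a, fun h' => ?_, Eventually.of_forall fun x => ?_⟩
      · by_cases hh' : h' = ⟨h, hh⟩
        · subst hh'
          simpa using ha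
        · simp [Pi.single_eq_of_ne hh']
      · rw [Finset.sum_eq_single ⟨h, hh⟩]
        · simp
        · intro h' _ hh'
          simp [Pi.single_eq_of_ne hh']
        · simp
    · refine ⟨0, fun _ => zero_mem _, ?_⟩
      filter_upwards [hf] with x hx
      simpa using hx
  · exact ⟨0, fun _ => zero_mem _, Eventually.of_forall fun x => by simp⟩
  · rintro f g - - ⟨A, hA, hf⟩ ⟨B, hB, hg⟩
    refine ⟨A + B, fun h => add_mem (hA h) (hB h), ?_⟩
    filter_upwards [hf, hg] with x hx hx'
    change f x + g x = _
    rw [hx, hx', ← Finset.sum_add_distrib]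
    exact Finset.sum_congr rfl fun h _ => (add_mul (A h x) (B h x) (h.1 x)).symm
  · rintro c f - ⟨A, hA, hf⟩
    refine ⟨c • A, fun h => Submodule.smul_mem _ c (hA h), ?_⟩
    filter_upwards [hf] with x hx
    change c * f x = _
    rw [hx, Finset.mul_sum]
    exact Finset.sum_congr rfl fun h _ => (mul_assoc c (A h x) (h.1 x)).symm

variable [IsManifold (𝓡 n) ∞ M]

/-- The field `P` is a decaying perturbation of `X`, where `X` moves `τ` at unit speed near
infinity and `ρ` is the rate of decay. -/
structure IsDecayingPerturbation (X P : SmoothVectorField n M) (τ ρ : C^∞⟮𝓡 n, M; ℝ⟯) (ε : ℝ) :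
    Prop where
  isExhausting : IsExhausting τ
  deriv_eq_one : ∀ᶠ x in cocompact M, fieldDeriv X τ x = 1
  pos : 0 < ε
  rate : ∀ᶠ x in cocompact M, ρ x = τ x ^ (-(1 + ε))
  map_bounded : ∀ f ∈ boundedSubmodule X, fieldOperator P f ∈ decayingSubmodule X ρ
  map_self : fieldOperator P τ =ᶠ[cocompact M] (0 : C^∞⟮𝓡 n, M; ℝ⟯)

namespace IsDecayingPerturbation

variable {X P : SmoothVectorField n M} {τ ρ : C^∞⟮𝓡 n, M; ℝ⟯} {ε : ℝ}

theorem add_deriv_eq_one (h : IsDecayingPerturbation X P τ ρ ε) :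
    ∀ᶠ x in cocompact M, fieldDeriv (X + P) τ x = 1 := by
  filter_upwards [h.deriv_eq_one, h.map_self] with x hx hx'
  have h1 : fieldDeriv P τ x = 0 := hx'
  rw [fieldDeriv_add_field, hx, h1, add_zero]

theorem exists_bound (h : IsDecayingPerturbation X P τ ρ ε) {f : C^∞⟮𝓡 n, M; ℝ⟯}
    (hf : f ∈ decayingSubmodule X ρ) :
    ∃ C, ∀ᶠ x in cocompact M, |f x| ≤ C * τ x ^ (-(1 + ε)) := by
  obtain ⟨b, hb, hfb⟩ := hf
  obtain ⟨C, hC⟩ := exists_bound_of_mem_boundedSubmodule hb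
  refine ⟨C, ?_⟩
  filter_upwards [hfb, h.rate, h.isExhausting.eventually_lt 0] with x hx hρ hpos
  have h1 : f x = ρ x * b x := hx
  rw [h1, hρ, abs_mul, abs_of_nonneg (Real.rpow_nonneg hpos.le _), mul_comm]
  exact mul_le_mul_of_nonneg_right (hC x) (Real.rpow_nonneg hpos.le _)

variable [T2Space M]

theorem perturbation_mem (h : IsDecayingPerturbation X P τ ρ ε) {ι : Type*} [Fintype ι]
    {u : ι → C^∞⟮𝓡 n, M; ℝ⟯} {V : ι → SmoothVectorField n M} (hV : IsConstantFrame X τ u V)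
    (l : ι) : fieldOperator P (u l) ∈ decayingSubmodule X ρ := by
  rcases hV.invariant_or_eq l with hl | hl
  · exact h.map_bounded _ (IsInvariant.mem_boundedSubmodule h.isExhausting h.deriv_eq_one hl)
  · rw [hl]
    exact mem_decayingSubmodule_of_eventuallyEq_zero h.map_self

variable [SecondCountableTopology M]

/-- Differentiating the rate costs only a bounded factor: `Z(ρ) = -(1 + ε) ρ τ⁻¹ Z(τ)`, where `τ⁻¹`
and `Z(τ)` are bounded with all derivatives. -/
theorem fieldOperator_mem (h : IsDecayingPerturbation X P τ ρ ε) {Z : SmoothVectorField n M}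
    (hZ : IsConstantField X Z) {f : C^∞⟮𝓡 n, M; ℝ⟯} (hf : f ∈ decayingSubmodule X ρ) :
    fieldOperator Z f ∈ decayingSubmodule X ρ := by
  obtain ⟨σ, hσ⟩ := exists_smooth_eq_near_infinity (n := n) (F := fun x => (τ x)⁻¹) (by
    filter_upwards [h.isExhausting.eventually_lt 0] with x hx
    exact (contDiffAt_inv ℝ hx.ne').contMDiffAt.comp x τ.contMDiff.contMDiffAt)
  have hσA := mem_boundedSubmodule_of_eventuallyEq_inv h.isExhausting h.deriv_eq_one hσ
  have hτA := (isInvariant_fieldOperator_of_deriv_eq_one hZ h.deriv_eq_one).mem_boundedSubmodule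
    h.isExhausting h.deriv_eq_one
  obtain ⟨b, hb, hfb⟩ := hf
  refine mem_decayingSubmodule_of_eventuallyEq ?_ (fieldOperator_eventuallyEq Z hfb)
  rw [fieldOperator_mul]
  refine add_mem ?_ ⟨_, fieldOperator_mem_boundedSubmodule hZ hb, Eventually.of_forall fun _ => rfl⟩
  refine ⟨(-(1 + ε)) • (σ * fieldOperator Z τ * b), Submodule.smul_mem _ _
    (mul_mem_boundedSubmodule (mul_mem_boundedSubmodule hσA hτA) hb), ?_⟩
  filter_upwards [eventually_nhds_of_eventually_cocompact h.rate, hσ,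
    h.isExhausting.eventually_lt 0] with x hx hxσ hpos
  have h1 : fieldDeriv Z ρ x = (-(1 + ε) * τ x ^ (-(1 + ε) - 1)) * fieldDeriv Z τ x :=
    (fieldDeriv_congr Z hx).trans (fieldDeriv_comp Z (Real.hasDerivAt_rpow_const (Or.inl hpos.ne'))
      (mdifferentiableAt_function τ x))
  change fieldDeriv Z ρ x * b x = ρ x * (-(1 + ε) * (σ x * fieldDeriv Z τ x * b x))
  rw [h1, Real.rpow_sub_one hpos.ne', ← hx.self_of_nhds, hxσ]
  ring

/-- Since `[X, Z] = 0` near infinity, only `P(Z u_l) - Z(P u_l)` remains, and `Z u_l` is invariant.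
-/
theorem bracket_mem (h : IsDecayingPerturbation X P τ ρ ε) {ι : Type*} [Fintype ι]
    {u : ι → C^∞⟮𝓡 n, M; ℝ⟯} {V : ι → SmoothVectorField n M} (hV : IsConstantFrame X τ u V)
    {Z : SmoothVectorField n M} (hZ : IsConstantField X Z) (l : ι) :
    fieldOperator (bracketField (X + P) Z) (u l) ∈ decayingSubmodule X ρ := by
  have h1 := h.map_bounded _ ((hV.isInvariant_fieldOperator h.deriv_eq_one hZ
    l).mem_boundedSubmodule h.isExhausting h.deriv_eq_one)
  have h2 := h.fieldOperator_mem hZ (h.perturbation_mem hV l)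
  refine mem_decayingSubmodule_of_eventuallyEq (sub_mem h1 h2) ?_
  rw [fieldOperator_bracketField, fieldOperator_add, fieldOperator_add, map_add]
  filter_upwards [hZ.fieldOperator_comm (u l)] with x hx
  simp only [ContMDiffMap.coe_sub, ContMDiffMap.coe_add, Pi.sub_apply, Pi.add_apply, hx]
  ring

end IsDecayingPerturbation

/-- A set of functions which satisfies a linear system with decaying coefficients along `Y`. -/
def IsDecayingSystem (X : SmoothVectorField n M) (ρ : C^∞⟮𝓡 n, M; ℝ⟯) (Y : SmoothVectorField n M)
    (H : Set C^∞⟮𝓡 n, M; ℝ⟯) : Prop :=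
  ∀ h ∈ H, fieldOperator Y h ∈ nearSpan {f | ∃ a ∈ decayingSubmodule X ρ, ∃ h ∈ H, f = a * h}

/-! ### Derivative bounds for decaying systems and the two inclusions. -/

namespace IsDecayingPerturbation

variable {X P : SmoothVectorField n M} {τ ρ : C^∞⟮𝓡 n, M; ℝ⟯} {ε : ℝ}

theorem exists_bound_of_system (h : IsDecayingPerturbation X P τ ρ ε) {H : Set C^∞⟮𝓡 n, M; ℝ⟯}
    (hH : H.Finite) (hsys : IsDecayingSystem X ρ (X + P) H) {f : C^∞⟮𝓡 n, M; ℝ⟯} (hf : f ∈ H) :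
    ∃ C, ∀ x, |f x| ≤ C := by
  have : Fintype H := hH.fintype
  choose A hA hAeq using fun f : H => exists_coefficients_of_mem_nearSpan (hsys f.1 f.2)
  exact bounded_of_linear_system h.isExhausting h.add_deriv_eq_one h.pos (fun f : H => f.1)
    (fun i j x => A i j x) (fun i j => h.exists_bound (hA i j)) hAeq ⟨f, hf⟩

variable [T2Space M] [SecondCountableTopology M]

/-- `Y V_k g = [Y, V_k] g + V_k(Y g)`: the bracket expands in the frame with decaying coefficients,
and `V_k` of a decaying combination of `H` is one of the enlarged set. Only the finitely many `V_k`
are used, so finiteness survives. -/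
theorem system_extend (h : IsDecayingPerturbation X P τ ρ ε) {ι : Type*} [Fintype ι]
    {u : ι → C^∞⟮𝓡 n, M; ℝ⟯} {V : ι → SmoothVectorField n M} (hV : IsConstantFrame X τ u V)
    {H : Set C^∞⟮𝓡 n, M; ℝ⟯} (hsys : IsDecayingSystem X ρ (X + P) H) :
    IsDecayingSystem X ρ (X + P) (H ∪ ⋃ k, fieldOperator (V k) '' H) := by
  set H' := H ∪ ⋃ k, fieldOperator (V k) '' H with hH'
  have hmem : ∀ k, ∀ g ∈ H, fieldOperator (V k) g ∈ H' := fun k g hg =>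
    Or.inr (Set.mem_iUnion.2 ⟨k, g, hg, rfl⟩)
  have hmono : ∀ f ∈ nearSpan {f | ∃ a ∈ decayingSubmodule X ρ, ∃ h ∈ H, f = a * h},
      f ∈ nearSpan {f | ∃ a ∈ decayingSubmodule X ρ, ∃ h ∈ H', f = a * h} := by
    refine fun f hf => Submodule.span_mono (Set.union_subset_union_left _ ?_) hf
    rintro _ ⟨a, ha, g, hg, rfl⟩
    exact ⟨a, ha, g, Or.inl hg, rfl⟩
  have hderiv : ∀ k, ∀ f ∈ nearSpan {f | ∃ a ∈ decayingSubmodule X ρ, ∃ h ∈ H, f = a * h},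
      fieldOperator (V k) f ∈
        nearSpan {f | ∃ a ∈ decayingSubmodule X ρ, ∃ h ∈ H', f = a * h} := by
    intro k f hf
    refine Submodule.span_induction (p := fun f _ => fieldOperator (V k) f ∈
      nearSpan {f | ∃ a ∈ decayingSubmodule X ρ, ∃ h ∈ H', f = a * h}) ?_ ?_ ?_ ?_ hf
    · rintro f (⟨a, ha, g, hg, rfl⟩ | hf)
      · rw [fieldOperator_mul]
        exact add_mem
          (subset_nearSpan ⟨_, h.fieldOperator_mem (hV.isConstantField k) ha, g, Or.inl hg, rfl⟩)
          (subset_nearSpan ⟨a, ha, _, hmem k g hg, rfl⟩)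
      · have h0 := fieldOperator_eventuallyEq (V k) (f := f) (g := 0) hf
        rw [map_zero] at h0
        exact mem_nearSpan_of_eventuallyEq (zero_mem _) h0
    · rw [map_zero]
      exact zero_mem _
    · intro f g _ _ hf hg
      rw [map_add]
      exact add_mem hf hg
    · intro c f _ hf
      rw [map_smul]
      exact Submodule.smul_mem _ c hf
  rintro f (hf | hf)
  · exact hmono _ (hsys f hf)
  · obtain ⟨k, g, hg, rfl⟩ := Set.mem_iUnion.1 hf
    have hbr := fieldOperator_bracketField (X + P) (V k) g
    rw [← sub_add_cancel (fieldOperator (X + P) (fieldOperator (V k) g))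
      (fieldOperator (V k) (fieldOperator (X + P) g)), ← hbr]
    refine add_mem ?_ (hderiv k _ (hsys g hg))
    refine mem_nearSpan_of_eventuallyEq ?_ (hV.fieldDeriv_eq_sum _ g)
    exact sum_mem fun l _ => subset_nearSpan
      ⟨_, h.bracket_mem hV (hV.isConstantField k) l, _, hmem l g hg, rfl⟩

/-- Solutions of a linear system with decaying coefficients are bounded with all their
derivatives. -/
theorem mem_boundedSubmodule_of_system (h : IsDecayingPerturbation X P τ ρ ε)
    {H : Set C^∞⟮𝓡 n, M; ℝ⟯} (hH : H.Finite) (hsys : IsDecayingSystem X ρ (X + P) H) :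
    ∀ f ∈ H, f ∈ boundedSubmodule X := by
  obtain ⟨ι, _, u, V, hV⟩ := exists_constant_frame h.isExhausting h.deriv_eq_one
  intro f hf
  -- The invariant factor `a` absorbs the coefficients `Z(u l)` when a general constant field `Z` is
  -- expanded in the frame; `H` varies because each derivative enlarges it.
  refine nearSpan_le_boundedSubmodule (G := {f | ∃ a, IsInvariant X a ∧
    ∃ H : Set C^∞⟮𝓡 n, M; ℝ⟯, H.Finite ∧ IsDecayingSystem X ρ (X + P) H ∧ ∃ g ∈ H, f = a * g})
    ?_ ?_ (subset_nearSpan ⟨1, isInvariant_one X, H, hH, hsys, f, hf, (one_mul f).symm⟩)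
  · rintro _ ⟨a, ha, H, hH, hsys, g, hg, rfl⟩
    obtain ⟨C, hC⟩ := ha.exists_bound h.isExhausting h.deriv_eq_one
    obtain ⟨C', hC'⟩ := h.exists_bound_of_system hH hsys hg
    exact ⟨C * C', Eventually.of_forall fun x => (abs_mul _ _).trans_le
      (mul_le_mul (hC x) (hC' x) (abs_nonneg _) ((abs_nonneg _).trans (hC x)))⟩
  · rintro Z hZ _ ⟨a, ha, H, hH, hsys, g, hg, rfl⟩
    rw [fieldOperator_mul]
    refine add_mem (subset_nearSpan
      ⟨_, ha.fieldOperator_of_isConstantField hZ, H, hH, hsys, g, hg, rfl⟩) ?_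
    refine mem_nearSpan_of_eventuallyEq
      (g := ∑ l, (a * fieldOperator Z (u l)) * fieldOperator (V l) g) ?_ ?_
    · exact sum_mem fun l _ => subset_nearSpan
        ⟨_, ha.mul (hV.isInvariant_fieldOperator h.deriv_eq_one hZ l), _,
          hH.union (Set.finite_iUnion fun k => hH.image _), h.system_extend hV hsys, _,
          Or.inr (Set.mem_iUnion.2 ⟨l, g, hg, rfl⟩), rfl⟩
    · simp only [mul_assoc, ← Finset.mul_sum]
      filter_upwards [hV.fieldDeriv_eq_sum Z g] with x hx
      exact congrArg (a x * ·) hx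

theorem boundedSubmodule_le (h : IsDecayingPerturbation X P τ ρ ε) :
    boundedSubmodule X ≤ boundedSubmodule (X + P) := by
  obtain ⟨ι, _, u, V, hV⟩ := exists_constant_frame h.isExhausting h.deriv_eq_one
  refine le_boundedSubmodule (fun f hf => exists_bound_of_mem_boundedSubmodule hf)
    fun Z hZ f hf => ?_
  -- Here `Z` commutes with `X + P`. Since `X(u_l)` is constant near infinity, `(X + P)(Z u_l) = Z(P
  -- u_l)`, and its expansion in the frame is a decaying system for the `Z(u_j)`.
  have hu : ∀ l, fieldOperator Z (u l) ∈ boundedSubmodule X := by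
    refine fun l => h.mem_boundedSubmodule_of_system
      (H := Set.range fun l => fieldOperator Z (u l)) (Set.finite_range _) ?_ _ ⟨l, rfl⟩
    rintro _ ⟨l, rfl⟩
    refine mem_nearSpan_of_eventuallyEq ?_ (hZ.fieldOperator_comm (u l))
    rw [fieldOperator_add, map_add]
    refine add_mem (mem_nearSpan_of_eventuallyEq (zero_mem _) ?_)
      (mem_nearSpan_of_eventuallyEq ?_ (hV.fieldDeriv_eq_sum Z (fieldOperator P (u l))))
    · rcases hV.invariant_or_eq l with hl | hl
      · have h0 := fieldOperator_eventuallyEq Z (f := fieldOperator X (u l)) (g := 0) hl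
        rwa [map_zero] at h0
      · have h1 : fieldOperator X (u l) =ᶠ[cocompact M] (1 : C^∞⟮𝓡 n, M; ℝ⟯) := by
          rw [hl]
          exact h.deriv_eq_one
        filter_upwards [fieldOperator_eventuallyEq Z h1] with x hx
        exact hx.trans (fieldDeriv_const Z 1 x)
    · refine sum_mem fun j _ => subset_nearSpan ⟨_, h.fieldOperator_mem (hV.isConstantField j)
        (h.perturbation_mem hV l), _, ⟨j, rfl⟩, mul_comm _ _⟩
  refine mem_boundedSubmodule_of_eventuallyEq ?_ (hV.fieldDeriv_eq_sum Z f)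
  exact sum_mem fun l _ => mul_mem_boundedSubmodule (hu l)
    (fieldOperator_mem_boundedSubmodule (hV.isConstantField l) hf)

theorem le_boundedSubmodule_add (h : IsDecayingPerturbation X P τ ρ ε) :
    boundedSubmodule (X + P) ≤ boundedSubmodule X := by
  obtain ⟨ι, _, w, W, hW⟩ := exists_constant_frame h.isExhausting h.add_deriv_eq_one
  refine le_boundedSubmodule (fun f hf => exists_bound_of_mem_boundedSubmodule hf)
    fun Z hZ f hf => ?_
  -- Not the mirror image of the other inclusion, as decay of `P` relative to `X + P` is not
  -- available. An invariant `w l` is instead bounded with all `X`-derivatives as a system on its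
  -- own, and the inclusion already proved is applied to `Z(w l)`.
  have hw : ∀ l, fieldOperator Z (w l) ∈ boundedSubmodule (X + P) := by
    refine fun l => h.boundedSubmodule_le ?_
    rcases hW.invariant_or_eq l with hl | hl
    · refine fieldOperator_mem_boundedSubmodule hZ (h.mem_boundedSubmodule_of_system
        (H := {w l}) (Set.finite_singleton _) ?_ _ rfl)
      rintro _ rfl
      exact mem_nearSpan_of_eventuallyEq (zero_mem _) hl
    · rw [hl]
      exact (isInvariant_fieldOperator_of_deriv_eq_one hZ h.deriv_eq_one).mem_boundedSubmodule
        h.isExhausting h.deriv_eq_one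
  refine mem_boundedSubmodule_of_eventuallyEq ?_ (hW.fieldDeriv_eq_sum Z f)
  exact sum_mem fun l _ => mul_mem_boundedSubmodule (hw l)
    (fieldOperator_mem_boundedSubmodule (hW.isConstantField l) hf)

end IsDecayingPerturbation

end DecayingPerturbation

end CylindricalEnd

end

/-! ### The theorem: strong boundedness yields a decaying perturbation. -/

theorem mainTheorem7 {n : ℕ} {M : Type*} [TopologicalSpace M]
    [ChartedSpace (EuclideanSpace ℝ (Fin n)) M] [IsManifold (𝓡 n) ∞ M]
    [T2Space M] [SecondCountableTopology M] [NoncompactSpace M]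
    (t : M → ℝ) (X Y Yperp : CylindricalEnd.SmoothVectorField n M)
    (hX : CylindricalEnd.IsCylindricalStructure t X)
    (hY : Y = X + Yperp)
    (hperp : CylindricalEnd.IsPerpendicular t Yperp)
    (ε : ℝ) (hε : 0 < ε)
    (hbdd : CylindricalEnd.IsStronglyBoundedNearInfinity X
      (fun x => (t x ^ (1 + ε)) • Yperp x)) :
    CylindricalEnd.IsCylindricalStructure t Y ∧
      ∀ f : C^∞⟮𝓡 n, M; ℝ⟯,
        CylindricalEnd.IsBoundedWithDerivatives X f ↔
          CylindricalEnd.IsBoundedWithDerivatives Y f := by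
  open CylindricalEnd in
  subst hY
  refine ⟨⟨hX.smooth, hX.proper, hX.bddBelow, ?_⟩, ?_⟩
  · filter_upwards [hX.deriv_eq_one, hperp] with x h1 h2
    rw [fieldDeriv_add_field, h1, h2, add_zero]
  obtain ⟨τ, hτ, hτt⟩ := exists_smooth_exhaustion hX.smooth hX.proper hX.bddBelow
  have hτt' := eventually_nhds_of_eventually_cocompact hτt
  obtain ⟨ρ, hρ⟩ := exists_smooth_eq_near_infinity (n := n) (F := fun x => τ x ^ (-(1 + ε))) (by
    filter_upwards [hτ.eventually_lt 0] with x hx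
    exact (Real.contDiffAt_rpow_const_of_ne hx.ne').contMDiffAt.comp x τ.contMDiff.contMDiffAt)
  obtain ⟨W, ⟨m, g, V, hg, hV, hWsum⟩, hW⟩ := hbdd
  have key : IsDecayingPerturbation X Yperp τ ρ ε := by
    refine ⟨hτ, ?_, hε, hρ, fun f hf => ?_, ?_⟩
    · filter_upwards [hτt', hX.deriv_eq_one] with x hx h1
      exact (fieldDeriv_congr X hx).trans h1
    -- The witness is `W f`, which is in the algebra by strong boundedness of `W`; dividing by `t ^
    -- (1 + ε)` near infinity gives the factor `ρ`.
    · refine ⟨∑ i, g i * fieldOperator (V i) f, sum_mem fun i _ => mul_mem_boundedSubmodule (hg i)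
        (fieldOperator_mem_boundedSubmodule (hV i) hf), ?_⟩
      filter_upwards [hτt, hW, hρ, hτ.eventually_lt 0] with x hx hWx hρx hpos
      have h1 : fieldDeriv W f x = t x ^ (1 + ε) * fieldDeriv Yperp f x := by
        rw [fieldDeriv, hWx]
        exact map_smul (mvfderiv (𝓡 n) f x) _ _
      have h2 : fieldDeriv W f x = ∑ i, g i x * fieldDeriv (V i) f x := by
        rw [fieldDeriv, hWsum, map_sum]
        exact Finset.sum_congr rfl fun i _ => map_smul (mvfderiv (𝓡 n) f x) _ _
      have h3 : (∑ i, g i * fieldOperator (V i) f : C^∞⟮𝓡 n, M; ℝ⟯) x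
          = ∑ i, g i x * fieldDeriv (V i) f x := sum_function_apply _ _ _
      change fieldDeriv Yperp f x = ρ x * (∑ i, g i * fieldOperator (V i) f : C^∞⟮𝓡 n, M; ℝ⟯) x
      rw [h3, ← h2, h1, hρx, ← hx, ← mul_assoc, ← Real.rpow_add hpos]
      simp
    · filter_upwards [hτt', hperp] with x hx h1
      exact (fieldDeriv_congr Yperp hx).trans h1
  exact fun f => ⟨fun hf => key.boundedSubmodule_le hf, fun hf => key.le_boundedSubmodule_add hf⟩
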